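/- Notation. $\mathbb C_+$ is the open upper half-plane. $H^2(\mathbb C_+)$ is the Hardy space of analytic functions $f$ on $\mathbb C_+$ with $\sup_{y>0}\int_{\mathbb R}|f(x+iy)|^2\,dx<\infty$. It is identified with a closed subspace of $L^2(\mathbb R)$ through the boundary functions $f(x)=\lim_{t\to0^+}f(x+it)$, which exist for almost every $x$, and $P_+:L^2(\mathbb R)\to H^2(\mathbb C_+)$ is the orthogonal projection. For $\varphi\in L^\infty(\mathbb R)$ let $T_\varphi f=P_+(\varphi f)$ for $f\in H^2(\mathbb C_+)$. If $\|\varphi\|_\infty\le1$, let $A=(\mathrm{Id}-T_\varphi T_{\overline\varphi})^{1/2}$. The de Branges--Rovnyak space $\mathcal H(\varphi)$ is the range of $A$, with the inner product $\langle Af_1,Af_2\rangle_\varphi=\langle f_1,f_2\rangle_{2}$ for $f_1,f_2\in H^2(\mathbb C_+)\ominus\ker A$; inner products are linear in the first variable. Let $b$ be in the closed unit ball of $H^\infty(\mathbb C_+)$, that is, $b$ is analytic on $\mathbb C_+$ and $|b|\le1$ there; on $\mathbb R$, $b$ denotes its boundary function (radial limits, which exist almost everywhere). Put $\rho(t)=1-|b(t)|^2$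 for almost every $t\in\mathbb R$, and let $L^2(\rho)=L^2(\mathbb R,\rho(t)\,dt)$. Let $H^2(\rho)$ be the closed linear span in $L^2(\rho)$ of the Cauchy kernels $k_w(t)=\frac{i}{2\pi}\frac1{t-\overline w}$, $w\in\mathbb C_+$, and let $C_\rho:L^2(\rho)\to H^2(\mathbb C_+)$, $C_\rho(q)=P_+(q\rho)$. For $\omega\in\mathbb C_+$ and an integer $n\ge0$ define $$k^b_{\omega,n}(z)=n!\,\frac{i}{2\pi}\,\frac{1-b(z)\sum_{p=0}^n\frac{\overline{b^{(p)}(\omega)}}{p!}(z-\overline\omega)^p}{(z-\overline\omega)^{n+1}}\quad(z\in\mathbb C_+),$$ $$k^\rho_{\omega,n}(t)=n!\,\frac{i}{2\pi}\,\frac{\sum_{p=0}^n\frac{\overline{b^{(p)}(\omega)}}{p!}(t-\overline\omega)^p}{(t-\overline\omega)^{n+1}}\quad(t\in\mathbb R).$$ Statement. Let $f\in\mathcal H(b)$ and let $g\in H^2(\rho)$ be such that $T_{\overline b}f=C_\rho(g)$. Then, for all $\omega\in\mathbb C_+$ and every integer $n\ge0$, we have $k^b_{\omega,n}\in\mathcal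 H(b)$ and $k^\rho_{\omega,n}\in H^2(\rho)$, both integrals below converge absolutely, and $$f^{(n)}(\omega)=\langle f,k^b_{\omega,n}\rangle_b=\int_{\mathbb R}f(t)\,\overline{k^b_{\omega,n}(t)}\,dt+\int_{\mathbb R}g(t)\,\rho(t)\,\overline{k^\rho_{\omega,n}(t)}\,dt .$$ -/

import Mathlib

open MeasureTheory Filter Topology ComplexConjugate
open scoped ENNReal NNReal

noncomputable section

namespace DBR

/-- The open upper half-plane `ℂ₊`. -/
def upperHalf : Set ℂ := {z | 0 < z.im}

/-- `u : ℝ → ℂ` is (a representative of) the boundary function of `F : ℂ₊ → ℂ`: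
for almost every `x`, `F (x + i t) → u x` as `t → 0⁺`. -/
def HasBoundaryValues (F : ℂ → ℂ) (u : ℝ → ℂ) : Prop :=
  ∀ᵐ x : ℝ, Tendsto (fun t : ℝ => F (x + t * Complex.I)) (𝓝[>] 0) (𝓝 (u x))

/-- `F` is a function of the Hardy space `H²(ℂ₊)`: it is analytic on `ℂ₊` and
`sup_{y > 0} ‖F(· + i y)‖_{L²(ℝ)} < ∞`.  (Values of `F` off `ℂ₊` are irrelevant.) -/
def MemHardyTwo (F : ℂ → ℂ) : Prop :=
  DifferentiableOn ℂ F upperHalf ∧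
    ∃ C : ℝ≥0, ∀ y : ℝ, 0 < y →
      eLpNorm (fun x : ℝ => F (x + y * Complex.I)) 2 volume ≤ C

theorem aestronglyMeasurable_line {F : ℂ → ℂ} (hF : DifferentiableOn ℂ F upperHalf)
    {y : ℝ} (hy : 0 < y) :
    AEStronglyMeasurable (fun x : ℝ => F (x + y * Complex.I)) volume := by
  refine Continuous.aestronglyMeasurable ?_
  refine hF.continuousOn.comp_continuous (by fun_prop) fun x => ?_
  simp [upperHalf, hy]

/-- The functions of `H²(ℂ₊)` seen through their boundary functions, as a linear subspace
of `L²(ℝ)`. -/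
def hardyTwo : Submodule ℂ (Lp ℂ 2 (volume : Measure ℝ)) where
  carrier := {u | ∃ F : ℂ → ℂ, MemHardyTwo F ∧ HasBoundaryValues F u}
  zero_mem' := by
    refine ⟨0, ⟨differentiableOn_const 0, 0, fun y _ => ?_⟩, ?_⟩
    · simp
    · filter_upwards [Lp.coeFn_zero ℂ 2 (volume : Measure ℝ)] with x hx
      simp
  add_mem' := by
    rintro u v ⟨F, ⟨hF, C, hC⟩, hFu⟩ ⟨G, ⟨hG, D, hD⟩, hGv⟩
    refine ⟨F + G, ⟨hF.add hG, C + D, fun y hy => ?_⟩, ?_⟩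
    · calc eLpNorm (fun x : ℝ => (F + G) (x + y * Complex.I)) 2 volume
          ≤ eLpNorm (fun x : ℝ => F (x + y * Complex.I)) 2 volume
            + eLpNorm (fun x : ℝ => G (x + y * Complex.I)) 2 volume :=
            eLpNorm_add_le (aestronglyMeasurable_line hF hy)
              (aestronglyMeasurable_line hG hy) (by norm_num)
        _ ≤ ((C + D : ℝ≥0) : ℝ≥0∞) := by
            push_cast
            exact add_le_add (hC y hy) (hD y hy)
    · filter_upwards [hFu, hGv, Lp.coeFn_add u v] with x h1 h2 h3
      rw [h3]
      exact h1.add h2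
  smul_mem' := by
    rintro c u ⟨F, ⟨hF, C, hC⟩, hFu⟩
    refine ⟨c • F, ⟨hF.const_smul c, ‖c‖₊ * C, fun y hy => ?_⟩, ?_⟩
    · calc eLpNorm (fun x : ℝ => (c • F) (x + y * Complex.I)) 2 volume
          = ‖c‖ₑ * eLpNorm (fun x : ℝ => F (x + y * Complex.I)) 2 volume :=
            eLpNorm_const_smul c _ 2 volume
        _ ≤ ((‖c‖₊ * C : ℝ≥0) : ℝ≥0∞) := by
            push_cast
            exact mul_le_mul_right (hC y hy) _
    · filter_upwards [hFu, Lp.coeFn_smul c u] with x h1 h2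
      rw [h2]
      exact h1.const_smul c

/-- `H²(ℂ₊)` as a Hilbert space: the closed subspace of `L²(ℝ)` given by the boundary functions.
(The subspace `hardyTwo` is closed; taking the closure changes nothing and lets us use the
orthogonal projection without proving this first.) -/
abbrev H2 : Submodule ℂ (Lp ℂ 2 (volume : Measure ℝ)) := hardyTwo.topologicalClosure

/-- `P₊`, the orthogonal projection of `L²(ℝ)` onto `H²(ℂ₊)`. -/
def Pplus : Lp ℂ 2 (volume : Measure ℝ) →L[ℂ] H2 := H2.orthogonalProjectionOnto

/-- Multiplication by `φ ∈ L^∞(ℝ)` on `L²(ℝ)`. -/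
def mulOp (φ : Lp ℂ ∞ (volume : Measure ℝ)) :
    Lp ℂ 2 (volume : Measure ℝ) →L[ℂ] Lp ℂ 2 (volume : Measure ℝ) :=
  (ContinuousLinearMap.mul ℂ ℂ).holderL volume ∞ 2 2 φ

/-- The Toeplitz operator `T_φ f = P₊ (φ f)` on `H²(ℂ₊)`. -/
def toeplitz (φ : Lp ℂ ∞ (volume : Measure ℝ)) : H2 →L[ℂ] H2 :=
  Pplus ∘L mulOp φ ∘L H2.subtypeL

/-- The positive square root of a positive operator on a Hilbert space. -/
def opSqrt {H : Type*} [NormedAddCommGroup H] [InnerProductSpace ℂ H] [CompleteSpace H]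
    (A : H →L[ℂ] H) : H →L[ℂ] H :=
  CFC.sqrt A

/-- The operator `(Id - T_φ T_{φ̄})^{1/2}` on `H²(ℂ₊)`. -/
def defect (φ : Lp ℂ ∞ (volume : Measure ℝ)) : H2 →L[ℂ] H2 :=
  opSqrt (1 - toeplitz φ * toeplitz (star φ))

open Classical in
/-- For `u` in the range of `A`, the unique `x ∈ (ker A)ᗮ` with `A x = u`
(and `0` for `u` not in the range). -/
def rangePreimage (A : H2 →L[ℂ] H2) (u : H2) : H2 :=
  if h : ∃ x ∈ (LinearMap.ker A.toLinearMap)ᗮ, A x = u then h.choose else 0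

/-- The inner product `⟨u, v⟩_φ` of `ℋ(φ)`, linear in the first variable:
`⟨A x, A y⟩_φ = ⟨x, y⟩₂` for `x, y ∈ (ker A)ᗮ`, where `A = (Id - T_φ T_{φ̄})^{1/2}`.
(Mathlib's `inner ℂ` is linear in its second argument.) -/
def dbrInner (φ : Lp ℂ ∞ (volume : Measure ℝ)) (u v : H2) : ℂ :=
  inner ℂ (rangePreimage (defect φ) v) (rangePreimage (defect φ) u)

/-- The analytic function `F` on `ℂ₊` belongs to the de Branges-Rovnyak space `ℋ(φ)`: it is a
function of `H²(ℂ₊)` lying in the range of `(Id - T_φ T_{φ̄})^{1/2}`. -/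
def MemDBR (φ : Lp ℂ ∞ (volume : Measure ℝ)) (F : ℂ → ℂ) : Prop :=
  MemHardyTwo F ∧
    ∃ u ∈ LinearMap.range (defect φ).toLinearMap, HasBoundaryValues F (u : Lp ℂ 2 volume)

open Classical in
/-- The boundary function of `F ∈ H²(ℂ₊)`, as an element of `H²(ℂ₊) ⊆ L²(ℝ)`
(and `0` if `F` has no such boundary function). -/
def boundaryTwo (F : ℂ → ℂ) : H2 :=
  if h : ∃ u : H2, HasBoundaryValues F (u : Lp ℂ 2 volume) then h.choose else 0

/-- The (closed) unit ball of `H^∞(ℂ₊)`. -/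
structure HInftyBall where
  /-- the underlying function; its values off `ℂ₊` are irrelevant -/
  toFun : ℂ → ℂ
  differentiableOn : DifferentiableOn ℂ toFun upperHalf
  norm_le_one : ∀ z ∈ upperHalf, ‖toFun z‖ ≤ 1

instance : CoeFun HInftyBall (fun _ => ℂ → ℂ) := ⟨HInftyBall.toFun⟩

namespace HInftyBall

variable (b : HInftyBall)

open Classical in
/-- The boundary function of `b`, as an element of `L^∞(ℝ)`
(and `0` if `b` had no such boundary function). -/
def bdry : Lp ℂ ∞ (volume : Measure ℝ) :=
  if h : ∃ β : Lp ℂ ∞ (volume : Measure ℝ), HasBoundaryValues b β then h.choose else 0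

theorem norm_bdry_le : ∀ᵐ x : ℝ, ‖b.bdry x‖ ≤ 1 := by
  by_cases h : ∃ β : Lp ℂ ∞ (volume : Measure ℝ), HasBoundaryValues b β
  · have e : b.bdry = h.choose := by simp only [bdry]; rw [dif_pos h]
    filter_upwards [h.choose_spec] with x hx
    rw [e]
    refine le_of_tendsto hx.norm ?_
    filter_upwards [self_mem_nhdsWithin] with t ht
    exact b.norm_le_one _ (by simpa [upperHalf] using ht)
  · have e : b.bdry = 0 := by simp only [bdry]; rw [dif_neg h]
    rw [e]
    filter_upwards [Lp.coeFn_zero ℂ ∞ (volume : Measure ℝ)] with x hx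
    simp

/-- `ρ(t) = 1 - |b(t)|²` on the real line. -/
def rho (t : ℝ) : ℝ := 1 - ‖b.bdry t‖ ^ 2

/-- The measure `ρ(t) dt`. -/
def rhoMeasure : Measure ℝ := volume.withDensity fun t => ENNReal.ofReal (b.rho t)

/-- The space `L²(ρ)`. -/
abbrev L2rho : Type := Lp ℂ 2 b.rhoMeasure

theorem measurable_rho : Measurable b.rho :=
  measurable_const.sub ((Lp.stronglyMeasurable b.bdry).measurable.norm.pow_const 2)

theorem memLp_mul_rho (q : b.L2rho) :
    MemLp (fun t => q t * (b.rho t : ℂ)) 2 (volume : Measure ℝ) := by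
  have hq : Measurable (q : ℝ → ℂ) := (Lp.stronglyMeasurable q).measurable
  have hm : Measurable fun t => q t * (b.rho t : ℂ) :=
    hq.mul (Complex.measurable_ofReal.comp b.measurable_rho)
  refine ⟨hm.aestronglyMeasurable, ?_⟩
  have h1 := eLpNorm_lt_top_iff_lintegral_rpow_enorm_lt_top (μ := b.rhoMeasure)
    (f := (q : ℝ → ℂ)) (p := 2) (by norm_num) (by norm_num)
  have h2 := h1.1 (Lp.memLp q).2
  have hr : b.rhoMeasure = volume.withDensity fun t => ENNReal.ofReal (b.rho t) := rfl
  generalize hq' : (q : ℝ → ℂ) = q' at *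
  rw [hr, lintegral_withDensity_eq_lintegral_mul _
    b.measurable_rho.ennreal_ofReal (by fun_prop)] at h2
  rw [eLpNorm_lt_top_iff_lintegral_rpow_enorm_lt_top (by norm_num) (by norm_num)]
  refine lt_of_le_of_lt (lintegral_mono_ae ?_) h2
  filter_upwards [b.norm_bdry_le] with t ht
  have h0 : 0 ≤ b.rho t := by
    have := norm_nonneg (b.bdry t)
    unfold rho; nlinarith
  have h3 : b.rho t ≤ 1 := by unfold rho; nlinarith [sq_nonneg ‖b.bdry t‖]
  have e1 : ‖q' t * (b.rho t : ℂ)‖ₑ = ‖q' t‖ₑ * ENNReal.ofReal (b.rho t) := by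
    rw [enorm_mul]
    congr 1
    rw [← ofReal_norm, Complex.norm_real, Real.norm_of_nonneg h0]
  have h4 : ENNReal.ofReal (b.rho t) ≤ 1 := by simpa using h3
  simp only [ENNReal.toReal_ofNat, ENNReal.rpow_ofNat, Pi.mul_apply, e1]
  calc (‖q' t‖ₑ * ENNReal.ofReal (b.rho t)) ^ 2
      = ENNReal.ofReal (b.rho t) * ‖q' t‖ₑ ^ 2 * ENNReal.ofReal (b.rho t) := by ring
    _ ≤ ENNReal.ofReal (b.rho t) * ‖q' t‖ₑ ^ 2 * 1 := by gcongr
    _ = _ := mul_one _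

/-- The operator `C_ρ : L²(ρ) → H²(ℂ₊)`, `C_ρ(q) = P₊(q ρ)`. -/
def Crho (q : b.L2rho) : H2 := Pplus ((b.memLp_mul_rho q).toLp _)

/-- `H²(ρ)`: the closed linear span in `L²(ρ)` of the Cauchy kernels
`k_w(t) = (i / 2π) / (t - w̄)`, `w ∈ ℂ₊`. -/
def H2rho : Submodule ℂ b.L2rho :=
  (Submodule.span ℂ {q : b.L2rho | ∃ w ∈ upperHalf,
    (q : ℝ → ℂ) =ᵐ[b.rhoMeasure]
      fun t => Complex.I / (2 * Real.pi) * (1 / ((t : ℂ) - conj w))}).topologicalClosure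

/-- The kernel `k^b_{ω,n}`, a function on `ℂ₊`. -/
def kernelB (ω : ℂ) (n : ℕ) (z : ℂ) : ℂ :=
  n.factorial * (Complex.I / (2 * Real.pi) *
    ((1 - b z * ∑ p ∈ Finset.range (n + 1),
        conj (iteratedDeriv p b ω) / p.factorial * (z - conj ω) ^ p)
      / (z - conj ω) ^ (n + 1)))

/-- The kernel `k^ρ_{ω,n}`, a function on `ℝ`. -/
def kernelRho (ω : ℂ) (n : ℕ) (t : ℝ) : ℂ :=
  n.factorial * (Complex.I / (2 * Real.pi) *
    ((∑ p ∈ Finset.range (n + 1),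
        conj (iteratedDeriv p b ω) / p.factorial * ((t : ℂ) - conj ω) ^ p)
      / ((t : ℂ) - conj ω) ^ (n + 1)))

end HInftyBall

end DBR

end

noncomputable section

namespace DBR

/-! Let K be `hardyKernel ω n`, for which ⟨F, K⟩₂ = F⁽ⁿ⁾(ω) on H², and let A = (Id - T_b
T_b̄)^{1/2}. Pairing bF with K and expanding (bF)⁽ⁿ⁾(ω) by the Leibniz rule shows that T_b̄ K is a
finite combination of kernels of order at most n, with boundary function k^ρ
(`toeplitz_star_hardyKernelTwo`). Hence k^b = K - b · T_b̄ K = A²K (`hasBoundaryValues_kernelB`). As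
A is self-adjoint, ⟨f, A²K⟩_b = ⟨f, K⟩₂ = f⁽ⁿ⁾(ω) for f in the range of A
(`dbrInner_defect_defect`). On the other hand ⟨f, K⟩₂ = ⟨f, k^b⟩₂ + ⟨f, T_b T_b̄ K⟩₂, and the last
term is ⟨T_b̄ f, T_b̄ K⟩₂ = ⟨C_ρ g, k^ρ⟩₂, which is the integral of gρ against the conjugate of k^ρ.

The analytic input is the passage to boundary values. The boundary function of b exists by Fatou's
theorem (`exists_hasBoundaryValues_of_bounded`), proved by differentiating a Lipschitz boundary
primitive. The reproducing property of K comes from Cauchy's formula in terms of boundary values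
(`MemHardyTwo.cauchy_boundary`), a weak limit of the formula on horizontal lines. Finally, H²(ρ) is
spanned by kernels of order zero only; the higher ones lie in it because the orthogonality relations
can be differentiated in the pole (`hardyKernelRho_mem`). -/

theorem isOpen_upperHalf : IsOpen upperHalf := isOpen_lt continuous_const Complex.continuous_im

/-! ### Cauchy and Poisson formulas for functions continuous up to the real line. -/

theorem integrable_of_norm_le_div_one_add_sq {h : ℝ → ℂ} (hm : AEStronglyMeasurable h volume)
    {C : ℝ} (hC : ∀ x, ‖h x‖ ≤ C / (1 + x ^ 2)) : Integrable h := by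
  refine (integrable_inv_one_add_sq.const_mul C).mono' hm (Eventually.of_forall fun x => ?_)
  simpa [div_eq_mul_inv] using hC x

theorem continuous_real_of_continuousOn_closedHalf {H : ℂ → ℂ}
    (hc : ContinuousOn H {z | 0 ≤ z.im}) : Continuous fun x : ℝ => H x :=
  hc.comp_continuous Complex.continuous_ofReal fun x => by simp

/-- Cauchy's theorem for the half-plane. -/
theorem integral_real_eq_zero {H : ℂ → ℂ} (hc : ContinuousOn H {z | 0 ≤ z.im})
    (hd : DifferentiableOn ℂ H upperHalf) {C : ℝ}
    (hC : ∀ z : ℂ, 0 ≤ z.im → ‖H z‖ ≤ C / (1 + ‖z‖ ^ 2)) : ∫ x : ℝ, H x = 0 := by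
  have hint : Integrable fun x : ℝ => H x :=
    integrable_of_norm_le_div_one_add_sq
      (continuous_real_of_continuousOn_closedHalf hc).aestronglyMeasurable
      (C := C) fun x => by simpa using hC x (by simp)
  have hC0 : 0 ≤ C := by simpa using (norm_nonneg _).trans (hC 0 (by simp))
  have h1 : Tendsto (fun R : ℝ => ∫ x in (-R)..R, H x) atTop (𝓝 (∫ x : ℝ, H x)) :=
    intervalIntegral_tendsto_integral hint tendsto_neg_atTop_atBot tendsto_id
  have hfar : ∀ R : ℝ, 0 < R → ∀ z : ℂ, 0 ≤ z.im → R ≤ ‖z‖ → ‖H z‖ ≤ C / R ^ 2 := by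
    intro R hR z hz hRz
    refine (hC z hz).trans ?_
    gcongr
    nlinarith
  -- On the rectangle [-R, R] × [0, R] the three sides off the real axis have total length 4R and
  -- stay at distance at least R from 0.
  have h2 : ∀ R : ℝ, 0 < R → ‖∫ x in (-R)..R, H x‖ ≤ 4 * C / R := by
    intro R hR
    have key := Complex.integral_boundary_rect_eq_zero_of_continuousOn_of_differentiableOn H
      (-R : ℂ) (R + R * Complex.I) ?_ ?_
    · simp only [Complex.neg_re, Complex.ofReal_re, Complex.neg_im, Complex.ofReal_im, neg_zero,
        Complex.ofReal_zero, zero_mul, add_zero, Complex.add_re, Complex.mul_re, Complex.I_re,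
        mul_zero, Complex.I_im, mul_one, sub_self, Complex.add_im, Complex.mul_im, zero_add,
        smul_eq_mul] at key
      have e : ∫ x in (-R)..R, H x = (∫ x in (-R)..R, H (x + R * Complex.I))
          - Complex.I * (∫ y in (0 : ℝ)..R, H (R + y * Complex.I))
          + Complex.I * ∫ y in (0 : ℝ)..R, H ((-R : ℝ) + y * Complex.I) := by
        linear_combination key
      have b1 : ‖∫ x in (-R)..R, H (x + R * Complex.I)‖ ≤ C / R ^ 2 * |R - -R| := by
        refine intervalIntegral.norm_integral_le_of_norm_le_const fun x _ => ?_
        refine hfar R hR _ (by simpa using hR.le) ?_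
        simpa [abs_of_pos hR] using Complex.abs_im_le_norm (x + R * Complex.I)
      have b2 : ‖∫ y in (0 : ℝ)..R, H (R + y * Complex.I)‖ ≤ C / R ^ 2 * |R - 0| := by
        refine intervalIntegral.norm_integral_le_of_norm_le_const fun y hy => ?_
        rw [Set.uIoc_of_le hR.le] at hy
        refine hfar R hR _ (by simpa using hy.1.le) ?_
        simpa [abs_of_pos hR] using Complex.abs_re_le_norm (R + y * Complex.I)
      have b3 : ‖∫ y in (0 : ℝ)..R, H ((-R : ℝ) + y * Complex.I)‖ ≤ C / R ^ 2 * |R - 0| := by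
        refine intervalIntegral.norm_integral_le_of_norm_le_const fun y hy => ?_
        rw [Set.uIoc_of_le hR.le] at hy
        refine hfar R hR _ (by simpa using hy.1.le) ?_
        simpa [abs_of_pos hR] using Complex.abs_re_le_norm ((-R : ℝ) + y * Complex.I)
      rw [e]
      refine (norm_add_le _ _).trans ?_
      refine (add_le_add_left (norm_sub_le _ _) _).trans ?_
      rw [norm_mul, norm_mul, Complex.norm_I, one_mul, one_mul]
      refine (add_le_add (add_le_add b1 b2) b3).trans (le_of_eq ?_)
      rw [sub_neg_eq_add, sub_zero, abs_of_pos hR, abs_of_pos (by linarith)]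
      field_simp
      ring
    · refine hc.mono fun z hz => ?_
      have := hz.2
      simp only [Complex.neg_im, Complex.ofReal_im, neg_zero, Complex.add_im, Complex.mul_im,
        Complex.ofReal_re, Complex.I_im, mul_one, Complex.I_re, mul_zero, add_zero, zero_add,
        Set.uIcc_of_le hR.le] at this
      exact this.1
    · refine hd.mono fun z hz => ?_
      have := hz.2
      simp only [Complex.neg_im, Complex.ofReal_im, neg_zero, Complex.add_im, Complex.mul_im,
        Complex.ofReal_re, Complex.I_im, mul_one, Complex.I_re, mul_zero, add_zero, zero_add,
        min_eq_left hR.le] at this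
      exact this.1
  have h3 : Tendsto (fun R : ℝ => ∫ x in (-R)..R, H x) atTop (𝓝 0) := by
    refine squeeze_zero_norm' (a := fun R => 4 * C / R) ?_
      (tendsto_const_nhds.div_atTop tendsto_id)
    filter_upwards [eventually_gt_atTop 0] with R hR using h2 R hR
  exact tendsto_nhds_unique h1 h3

theorem ofReal_sub_ne_zero {w : ℂ} (hw : w.im ≠ 0) (t : ℝ) : (t : ℂ) - w ≠ 0 := by
  intro e
  rw [sub_eq_zero] at e
  exact hw (by simp [← e])

theorem im_le_norm_sub {z w : ℂ} (h : z.im ≤ 0) : w.im ≤ ‖z - w‖ := by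
  have := Complex.abs_im_le_norm (z - w)
  rw [Complex.sub_im, abs_sub_comm] at this
  exact le_trans (by linarith) ((le_abs_self _).trans this)

theorem im_le_norm_sub_conj {z w : ℂ} (hz : 0 ≤ z.im) : w.im ≤ ‖z - conj w‖ := by
  have := Complex.abs_im_le_norm (z - conj w)
  rw [Complex.sub_im, Complex.conj_im] at this
  exact le_trans (by linarith) ((le_abs_self _).trans this)

theorem norm_sub_conj_lower {w : ℂ} (hw : 0 < w.im) :
    ∃ c : ℝ, 0 < c ∧ ∀ z : ℂ, 0 ≤ z.im → c * (1 + ‖z‖) ≤ ‖z - conj w‖ := by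
  -- With d = |z - w̄| ≥ Im w and |z| ≤ d + |w|, one gets Im w · (1 + |z|) ≤ d (1 + |w| + Im w).
  refine ⟨w.im / (1 + ‖w‖ + w.im), by positivity, fun z hz => ?_⟩
  have h1 := im_le_norm_sub_conj (w := w) hz
  have h2 : ‖z‖ ≤ ‖z - conj w‖ + ‖w‖ := by
    have := norm_add_le (z - conj w) (conj w)
    simpa using this
  have h3 := norm_nonneg w
  rw [div_mul_eq_mul_div, div_le_iff₀ (by positivity)]
  nlinarith

theorem norm_ofReal_sub_lower {w : ℂ} (hw : 0 < w.im) :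
    ∃ c : ℝ, 0 < c ∧ ∀ t : ℝ, c * (1 + |t|) ≤ ‖(t : ℂ) - w‖ := by
  obtain ⟨c, hc, h⟩ := norm_sub_conj_lower hw
  refine ⟨c, hc, fun t => ?_⟩
  have := h t (by simp)
  rwa [← Complex.norm_conj ((t : ℂ) - conj w), map_sub, Complex.conj_ofReal, Complex.conj_conj,
    Complex.norm_real, Real.norm_eq_abs] at this

theorem one_add_sq_le_sq (t : ℝ) : 1 + t ^ 2 ≤ (1 + |t|) ^ 2 := by
  nlinarith [abs_nonneg t, sq_abs t]

theorem integral_poisson {x y : ℝ} (hy : 0 < y) :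
    ∫ t : ℝ, (1 / ((t - x) ^ 2 + y ^ 2)) = Real.pi / y := by
  have e : ∀ t : ℝ, 1 / ((t - x) ^ 2 + y ^ 2)
      = (fun s => (1 / y ^ 2) * (fun r : ℝ => (1 + r ^ 2)⁻¹) (y⁻¹ * s)) (t - x) := by
    intro t
    simp only
    field_simp
    ring
  simp_rw [e]
  rw [integral_sub_right_eq_self (fun s => (1 / y ^ 2) * (fun r : ℝ => (1 + r ^ 2)⁻¹) (y⁻¹ * s)) x,
    integral_const_mul, Measure.integral_comp_mul_left (fun r : ℝ => (1 + r ^ 2)⁻¹),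
    integral_univ_inv_one_add_sq]
  simp only [inv_inv, smul_eq_mul, abs_of_pos hy]
  field_simp

theorem sub_conj_mul_sub (t : ℝ) (w : ℂ) :
    ((t : ℂ) - conj w) * (t - w) = (((t - w.re) ^ 2 + w.im ^ 2 : ℝ) : ℂ) := by
  apply Complex.ext
  · simp [pow_two]
  · simp [pow_two]
    ring

theorem integral_inv_sub_conj_mul_sub {w : ℂ} (hw : 0 < w.im) :
    ∫ t : ℝ, 1 / (((t : ℂ) - conj w) * (t - w)) = Real.pi / w.im := by
  simp_rw [sub_conj_mul_sub]
  have := integral_poisson (x := w.re) hw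
  rw [← Complex.ofReal_div, ← this, ← integral_complex_ofReal]
  simp

/-- Cauchy's formula for the half-plane. -/
theorem cauchy_formula {Φ : ℂ → ℂ} (hc : ContinuousOn Φ {z | 0 ≤ z.im})
    (hd : DifferentiableOn ℂ Φ upperHalf) {C : ℝ}
    (hC : ∀ z : ℂ, 0 ≤ z.im → ‖Φ z‖ ≤ C / (1 + ‖z‖)) {w : ℂ} (hw : 0 < w.im) :
    ∫ t : ℝ, Φ t / (t - w) = 2 * Real.pi * Complex.I * Φ w := by
  obtain ⟨c, hc0, hcw⟩ := norm_sub_conj_lower hw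
  obtain ⟨c', hc'0, hc'w⟩ := norm_ofReal_sub_lower hw
  have hC0 : 0 ≤ C := by simpa using (norm_nonneg _).trans (hC 0 (by simp))
  -- Subtracting A / (z - w̄) makes the function vanish at w without spoiling its decay, so that the
  -- quotient by z - w is analytic with quadratic decay and integrates to 0. The correction term
  -- contributes a Poisson integral of value A π / Im w = 2πi Φ(w).
  set A : ℂ := Φ w * (w - conj w) with hA
  set Ψ : ℂ → ℂ := fun z => Φ z - A / (z - conj w) with hΨ
  have hne : ∀ z : ℂ, 0 ≤ z.im → z - conj w ≠ 0 := fun z hz =>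
    norm_pos_iff.1 (hw.trans_le (im_le_norm_sub_conj hz))
  have hww : w - conj w ≠ 0 := hne w hw.le
  have hΨw : Ψ w = 0 := by
    simp only [hΨ, hA]
    field_simp
    ring
  have hΨc : ContinuousOn Ψ {z | 0 ≤ z.im} :=
    hc.sub (continuousOn_const.div (by fun_prop) fun z hz => hne z hz)
  have hΨd : DifferentiableOn ℂ Ψ upperHalf :=
    hd.sub ((differentiableOn_const _).div (by fun_prop) fun z hz => hne z (le_of_lt hz))
  have hΨC : ∀ z : ℂ, 0 ≤ z.im → ‖Ψ z‖ ≤ (C + ‖A‖ / c) / (1 + ‖z‖) := by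
    intro z hz
    refine (norm_sub_le _ _).trans ?_
    rw [add_div, norm_div]
    refine add_le_add (hC z hz) ?_
    rw [div_div]
    exact div_le_div_of_nonneg_left (norm_nonneg _) (by positivity) (hcw z hz)
  have hU : upperHalf ∈ 𝓝 w := isOpen_upperHalf.mem_nhds hw
  have hU' : {z : ℂ | 0 ≤ z.im} ∈ 𝓝 w := 
    mem_of_superset hU fun z (hz : 0 < z.im) => hz.le
  set H := dslope Ψ w with hH
  have hHc : ContinuousOn H {z | 0 ≤ z.im} :=
    (continuousOn_dslope hU').2 ⟨hΨc, hΨd.differentiableAt hU⟩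
  have hHd : DifferentiableOn ℂ H upperHalf := (Complex.differentiableOn_dslope hU).2 hΨd
  have hHv : ∀ z, z ≠ w → H z = Ψ z / (z - w) := by
    intro z hz
    rw [hH, dslope_of_ne _ hz, slope_def_field, hΨw, sub_zero]
  -- Beyond this radius |z - w| ≥ (1 + |z|) / 2; inside it compactness bounds the quotient.
  set R : ℝ := 2 * ‖w‖ + 1 with hR
  set D := C + ‖A‖ / c with hD
  have hD0 : 0 ≤ D := by positivity
  have hcpt : IsCompact ({z : ℂ | 0 ≤ z.im} ∩ Metric.closedBall 0 R) :=
    (isCompact_closedBall 0 R).inter_left (isClosed_le continuous_const Complex.continuous_im)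
  obtain ⟨M, hM⟩ := hcpt.exists_bound_of_continuousOn (hHc.mono Set.inter_subset_left)
  have hHC : ∀ z : ℂ, 0 ≤ z.im → ‖H z‖ ≤ (|M| * (1 + R ^ 2) + 2 * D) / (1 + ‖z‖ ^ 2) := by
    intro z hz
    rw [le_div_iff₀ (by positivity)]
    rcases le_or_gt ‖z‖ R with h | h
    · have h1 : ‖H z‖ ≤ |M| := (hM z ⟨hz, by simpa using h⟩).trans (le_abs_self M)
      have : ‖H z‖ * (1 + ‖z‖ ^ 2) ≤ |M| * (1 + R ^ 2) := by gcongr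
      linarith
    · have hzw : ‖z‖ ≤ ‖z - w‖ + ‖w‖ := by simpa using norm_add_le (z - w) w
      have hlow : (1 + ‖z‖) / 2 ≤ ‖z - w‖ := by linarith
      have hzne : z ≠ w := by
        rintro rfl
        have := norm_nonneg z
        linarith
      have hzn := norm_nonneg z
      have h1 : ‖H z‖ ≤ D / (1 + ‖z‖) / ((1 + ‖z‖) / 2) := by
        rw [hHv z hzne, norm_div]
        exact div_le_div₀ (by positivity) (hΨC z hz) (by positivity) hlow
      have h2 : ‖H z‖ * (1 + ‖z‖ ^ 2) ≤ D / (1 + ‖z‖) / ((1 + ‖z‖) / 2) * (1 + ‖z‖) ^ 2 := by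
        gcongr
        nlinarith
      have h3 : D / (1 + ‖z‖) / ((1 + ‖z‖) / 2) * (1 + ‖z‖) ^ 2 = 2 * D := by
        field_simp
      have : 0 ≤ |M| * (1 + R ^ 2) := by positivity
      linarith
  have h0 := integral_real_eq_zero hHc hHd hHC
  have hrw : ∀ t : ℝ, (t : ℂ) ≠ w := fun t h => by
    have := congrArg Complex.im h
    simp at this
    linarith
  have hrc : ∀ t : ℝ, (t : ℂ) - w ≠ 0 := ofReal_sub_ne_zero hw.ne'
  have i1 : Integrable fun t : ℝ => Φ t / (t - w) := by
    refine integrable_of_norm_le_div_one_add_sq (C := C / c') ?_ fun t => ?_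
    · exact ((continuous_real_of_continuousOn_closedHalf hc).div (by fun_prop)
        hrc).aestronglyMeasurable
    · rw [norm_div]
      have h1 := hC t (by simp)
      rw [Complex.norm_real, Real.norm_eq_abs] at h1
      refine (div_le_div₀ (by positivity) h1 (by positivity) (hc'w t)).trans ?_
      rw [div_div, div_div]
      refine div_le_div_of_nonneg_left hC0 (by positivity) ?_
      nlinarith [one_add_sq_le_sq t]
  have i2 : Integrable fun t : ℝ => A * (1 / (((t : ℂ) - conj w) * (t - w))) := by
    refine Integrable.const_mul ?_ _
    refine integrable_of_norm_le_div_one_add_sq (C := 1 / (c * c')) ?_ fun t => ?_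
    · have : Continuous fun t : ℝ => 1 / (((t : ℂ) - conj w) * (t - w)) :=
        continuous_const.div (by fun_prop) fun t => mul_ne_zero (hne t (by simp)) (hrc t)
      exact this.aestronglyMeasurable
    · rw [norm_div, norm_mul, norm_one, div_div]
      have h1 := hcw t (by simp)
      rw [Complex.norm_real, Real.norm_eq_abs] at h1
      refine div_le_div_of_nonneg_left zero_le_one (by positivity) ?_
      calc c * c' * (1 + t ^ 2) ≤ c * c' * (1 + |t|) ^ 2 := by gcongr; exact one_add_sq_le_sq t
        _ = (c * (1 + |t|)) * (c' * (1 + |t|)) := by ring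
        _ ≤ _ := mul_le_mul h1 (hc'w t) (by positivity) (norm_nonneg _)
  have e : ∀ t : ℝ, H t = Φ t / (t - w) - A * (1 / (((t : ℂ) - conj w) * (t - w))) := by
    intro t
    have h1 := hne t (by simp)
    have h2 := hrc t
    rw [hHv t (hrw t)]
    simp only [hΨ]
    field_simp
  simp_rw [e] at h0
  rw [integral_sub i1 i2, integral_const_mul, integral_inv_sub_conj_mul_sub hw, sub_eq_zero] at h0
  rw [h0, hA]
  have : w - conj w = 2 * w.im * Complex.I := by
    rw [Complex.sub_conj]; push_cast; ring
  rw [this]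
  have hi : (w.im : ℂ) ≠ 0 := by exact_mod_cast hw.ne'
  field_simp

/-- Poisson's formula for bounded analytic functions on the half-plane. -/
theorem poisson_formula {Φ : ℂ → ℂ} (hc : ContinuousOn Φ {z | 0 ≤ z.im})
    (hd : DifferentiableOn ℂ Φ upperHalf) {C : ℝ}
    (hC : ∀ z : ℂ, 0 ≤ z.im → ‖Φ z‖ ≤ C) {w : ℂ} (hw : 0 < w.im) :
    ∫ t : ℝ, Φ t / ((t - w.re) ^ 2 + w.im ^ 2 : ℝ) = Real.pi / w.im * Φ w := by
  obtain ⟨c, hc0, hcw⟩ := norm_sub_conj_lower hw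
  have hC0 : 0 ≤ C := (norm_nonneg _).trans (hC 0 (by simp))
  have hne : ∀ z : ℂ, 0 ≤ z.im → z - conj w ≠ 0 := fun z hz =>
    norm_pos_iff.1 (hw.trans_le (im_le_norm_sub_conj hz))
  -- Dividing by z - w̄ supplies the decay that Cauchy's formula needs, and turns its denominator
  -- into that of the Poisson kernel.
  have := cauchy_formula (Φ := fun z => Φ z / (z - conj w)) (C := C / c)
    (hc.div (by fun_prop) fun z hz => hne z hz)
    (hd.div (by fun_prop) fun z hz => hne z (le_of_lt hz)) (fun z hz => ?_) hw
  · simp_rw [div_div, sub_conj_mul_sub] at this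
    rw [this, Complex.sub_conj]
    have hi : (w.im : ℂ) ≠ 0 := by exact_mod_cast hw.ne'
    push_cast
    field_simp
  · rw [norm_div, div_div]
    exact div_le_div₀ hC0 (hC z hz) (by positivity) (hcw z hz)

/-! ### Fatou's theorem for bounded analytic functions. -/

theorem tendsto_add_mul_I (w : ℂ) (l : Filter ℝ) (hl : l ≤ 𝓝 0) :
    Tendsto (fun t : ℝ => w + t * Complex.I) l (𝓝 w) := by
  have h : Continuous fun t : ℝ => w + t * Complex.I := by fun_prop
  simpa using (h.tendsto 0).mono_left hl

/-- The primitive of `F` along the horizontal line at height `ε`. -/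
def linePrimitive (F : ℂ → ℂ) (ε t : ℝ) : ℂ := ∫ s in (0 : ℝ)..t, F (s + ε * Complex.I)

theorem continuous_line {F : ℂ → ℂ} (hF : DifferentiableOn ℂ F upperHalf) {y : ℝ} (hy : 0 < y) :
    Continuous fun x : ℝ => F (x + y * Complex.I) :=
  hF.continuousOn.comp_continuous (by fun_prop) fun x => by simp [upperHalf, hy]

theorem hasDerivAt_linePrimitive {F : ℂ → ℂ} (hF : DifferentiableOn ℂ F upperHalf) {ε : ℝ}
    (hε : 0 < ε) (t : ℝ) :
    HasDerivAt (linePrimitive F ε) (F (t + ε * Complex.I)) t :=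
  ((continuous_line hF hε).integral_hasStrictDerivAt 0 t).hasDerivAt

theorem linePrimitive_lipschitz {F : ℂ → ℂ} (hF : DifferentiableOn ℂ F upperHalf)
    (h1 : ∀ z ∈ upperHalf, ‖F z‖ ≤ 1) {ε : ℝ} (hε : 0 < ε) :
    LipschitzWith 1 (linePrimitive F ε) := by
  refine lipschitzWith_of_nnnorm_deriv_le
    (fun t => (hasDerivAt_linePrimitive hF hε t).differentiableAt) fun t => ?_
  rw [(hasDerivAt_linePrimitive hF hε t).deriv]
  exact h1 _ (by simp [upperHalf, hε])

/-- By Cauchy's theorem on the rectangle between the two heights, only the vertical sides over 0 and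
t remain, each contributing at most |ε - δ|. The bound makes the primitives Cauchy as ε → 0. -/
theorem linePrimitive_sub {F : ℂ → ℂ} (hF : DifferentiableOn ℂ F upperHalf)
    (h1 : ∀ z ∈ upperHalf, ‖F z‖ ≤ 1) {ε δ : ℝ} (hε : 0 < ε) (hδ : 0 < δ) (t : ℝ) :
    ‖linePrimitive F ε t - linePrimitive F δ t‖ ≤ 2 * |ε - δ| := by
  have hmem : ∀ y ∈ Set.uIcc ε δ, 0 < y := fun y hy => (lt_min hε hδ).trans_le hy.1
  have key := Complex.integral_boundary_rect_eq_zero_of_differentiableOn F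
    (ε * Complex.I) (t + δ * Complex.I) (hF.mono fun z hz => hmem _ (by simpa using hz.2))
  simp only [Complex.mul_re, Complex.ofReal_re, Complex.I_re, mul_zero, Complex.ofReal_im,
    Complex.I_im, mul_one, sub_self, Complex.add_re, add_zero, Complex.mul_im, Complex.add_im,
    zero_add, smul_eq_mul] at key
  have e : linePrimitive F ε t - linePrimitive F δ t
      = Complex.I * (∫ y in ε..δ, F ((0 : ℝ) + y * Complex.I))
        - Complex.I * ∫ y in ε..δ, F (t + y * Complex.I) := by
    unfold linePrimitive
    linear_combination key
  have hb : ∀ x : ℝ, ‖∫ y in ε..δ, F (x + y * Complex.I)‖ ≤ 1 * |δ - ε| := fun x =>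
    intervalIntegral.norm_integral_le_of_norm_le_const fun y hy =>
      h1 _ (by simpa [upperHalf] using hmem y (Set.uIoc_subset_uIcc hy))
  rw [e]
  refine (norm_sub_le _ _).trans ?_
  rw [norm_mul, norm_mul, Complex.norm_I, abs_sub_comm]
  linarith [hb 0, hb t]

theorem exists_boundary_primitive {F : ℂ → ℂ} (hF : DifferentiableOn ℂ F upperHalf)
    (h1 : ∀ z ∈ upperHalf, ‖F z‖ ≤ 1) :
    ∃ B : ℝ → ℂ, LipschitzWith 1 B ∧
      ∀ t, Tendsto (fun ε => linePrimitive F ε t) (𝓝[>] 0) (𝓝 (B t)) := by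
  have h : ∀ t, ∃ x, Tendsto (fun ε => linePrimitive F ε t) (𝓝[>] 0) (𝓝 x) := by
    intro t
    have hl : LipschitzOnWith 2 (fun ε => linePrimitive F ε t) (Set.Ioi 0) := by
      refine LipschitzOnWith.of_dist_le_mul fun ε hε δ hδ => ?_
      rw [dist_eq_norm, dist_eq_norm]
      exact linePrimitive_sub hF h1 hε hδ t
    have hc : Cauchy (𝓝[>] (0 : ℝ)) := cauchy_nhds.mono' inferInstance nhdsWithin_le_nhds
    exact CompleteSpace.complete
      (hc.map_of_le hl.uniformContinuousOn (le_principal_iff.2 self_mem_nhdsWithin))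
  choose B hB using h
  refine ⟨B, LipschitzWith.of_dist_le_mul fun s t => ?_, hB⟩
  refine le_of_tendsto ((hB s).dist (hB t)) ?_
  filter_upwards [self_mem_nhdsWithin] with ε hε
  exact (linePrimitive_lipschitz hF h1 hε).dist_le_mul s t

/-- A majorant independent of y, for dominated convergence: the difference quotient is at most |s|.
The weight is minus the derivative of 1 / (1 + s²). -/
theorem norm_slope_mul_le {B : ℝ → ℂ} (hB : LipschitzWith 1 B) (x : ℝ) {y : ℝ} (hy : 0 < y)
    (s : ℝ) : ‖(B (x + y * s) - B x) / y * (2 * s / (1 + s ^ 2) ^ 2 : ℝ)‖ ≤ 2 / (1 + s ^ 2) := by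
  have h1 : ‖B (x + y * s) - B x‖ ≤ y * |s| := by
    have := hB.dist_le_mul (x + y * s) x
    rw [dist_eq_norm, dist_eq_norm] at this
    simpa [abs_mul, abs_of_pos hy] using this
  rw [norm_mul, norm_div, Complex.norm_real, Complex.norm_real, Real.norm_of_nonneg hy.le,
    norm_div, norm_pow, Real.norm_of_nonneg (by positivity : 0 ≤ 1 + s ^ 2), Real.norm_eq_abs,
    abs_mul, abs_two]
  have h2 : ‖B (x + y * s) - B x‖ / y ≤ |s| := by
    rw [div_le_iff₀ hy]; linarith
  calc ‖B (x + y * s) - B x‖ / y * (2 * |s| / (1 + s ^ 2) ^ 2)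
      ≤ |s| * (2 * |s| / (1 + s ^ 2) ^ 2) := by gcongr
    _ = 2 * s ^ 2 / (1 + s ^ 2) ^ 2 := by rw [← sq_abs s]; ring
    _ ≤ 2 * (1 + s ^ 2) / (1 + s ^ 2) ^ 2 := by gcongr; linarith
    _ = 2 / (1 + s ^ 2) := by field_simp

/-- This is Poisson's formula at i for z ↦ F(x + yz + εi), integrated by parts so that F enters only
through its primitive. -/
theorem integral_slope_linePrimitive {F : ℂ → ℂ} (hF : DifferentiableOn ℂ F upperHalf)
    (h1 : ∀ z ∈ upperHalf, ‖F z‖ ≤ 1) (x : ℝ) {y ε : ℝ} (hy : 0 < y) (hε : 0 < ε) :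
    ∫ s : ℝ, (linePrimitive F ε (x + y * s) - linePrimitive F ε x) / y
        * (2 * s / (1 + s ^ 2) ^ 2 : ℝ)
      = Real.pi * F (x + y * Complex.I + ε * Complex.I) := by
  have hmem : ∀ z : ℂ, 0 ≤ z.im → (x + y * z + ε * Complex.I : ℂ) ∈ upperHalf := by
    intro z hz
    simp only [upperHalf, Set.mem_ofPred_eq, Complex.add_im, Complex.ofReal_im, Complex.mul_im,
      Complex.ofReal_re, Complex.I_im, Complex.I_re]
    nlinarith
  have hp := poisson_formula (Φ := fun z => F (x + y * z + ε * Complex.I)) (C := 1)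
    (hF.continuousOn.comp (by fun_prop) fun z hz => hmem z hz)
    (hF.comp (by fun_prop) fun z (hz : 0 < z.im) => hmem z hz.le) (fun z hz => h1 _ (hmem z hz))
    (w := Complex.I) (by simp)
  simp only [Complex.I_re, sub_zero, Complex.I_im, one_pow, Complex.ofReal_one, div_one] at hp
  have hLip := linePrimitive_lipschitz hF h1 hε
  set u : ℝ → ℂ := fun s => (linePrimitive F ε (x + y * s) - linePrimitive F ε x) / y with hu
  set u' : ℝ → ℂ := fun s => F (x + y * s + ε * Complex.I) with hu'
  set v : ℝ → ℂ := fun s => ((1 / (1 + s ^ 2) : ℝ) : ℂ) with hv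
  set v' : ℝ → ℂ := fun s => ((-(2 * s) / (1 + s ^ 2) ^ 2 : ℝ) : ℂ) with hv'
  have du : ∀ s, HasDerivAt u (u' s) s := by
    intro s
    have a := hasDerivAt_linePrimitive hF hε (x + y * s)
    have b : HasDerivAt (fun s : ℝ => x + y * s) y s := by
      simpa using ((hasDerivAt_id s).const_mul y).const_add x
    have c := ((a.scomp s b).sub_const (linePrimitive F ε x)).div_const (y : ℂ)
    have hy' : (y : ℂ) ≠ 0 := by exact_mod_cast hy.ne'
    have e : y • F ((x + y * s : ℝ) + ε * Complex.I) / y = u' s := by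
      simp only [hu', Complex.real_smul]
      push_cast
      field_simp
    rw [e] at c
    exact c
  have dv : ∀ s, HasDerivAt v (v' s) s := by
    intro s
    refine HasDerivAt.ofReal_comp ?_
    have a : HasDerivAt (fun s : ℝ => 1 + s ^ 2) (2 * s) s := by
      simpa using (hasDerivAt_pow 2 s).const_add 1
    simp only [one_div]
    exact a.inv (by positivity)
  have cu : Continuous u := continuous_iff_continuousAt.2 fun s => (du s).continuousAt
  have cv : Continuous v := continuous_iff_continuousAt.2 fun s => (dv s).continuousAt
  have cv' : Continuous v' := by
    refine Complex.continuous_ofReal.comp ?_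
    exact Continuous.div (by fun_prop) (by fun_prop) fun s => by positivity
  have cu' : Continuous u' :=
    hF.continuousOn.comp_continuous (by fun_prop) fun s => hmem s (by simp)
  have iuv' : Integrable (u * v') := by
    refine integrable_of_norm_le_div_one_add_sq (C := 2) (cu.mul cv').aestronglyMeasurable
      fun s => ?_
    have := norm_slope_mul_le hLip x hy s
    have e : v' s = -((2 * s / (1 + s ^ 2) ^ 2 : ℝ) : ℂ) := by
      simp only [hv']; push_cast; ring
    rw [Pi.mul_apply, e, mul_neg, norm_neg]
    exact this
  have iu'v : Integrable (u' * v) := by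
    refine integrable_of_norm_le_div_one_add_sq (C := 1) (cu'.mul cv).aestronglyMeasurable
      fun s => ?_
    rw [Pi.mul_apply, norm_mul]
    have := h1 _ (hmem s (by simp))
    have e : ‖v s‖ = 1 / (1 + s ^ 2) := by
      simp only [hv, Complex.norm_real]
      exact Real.norm_of_nonneg (by positivity)
    rw [e]
    exact mul_le_of_le_one_left (by positivity) this
  -- The boundary terms vanish: |u| ≤ |s| while |v| ≤ 1 / s².
  have huv : ∀ s : ℝ, s ≠ 0 → ‖(u * v) s‖ ≤ |s|⁻¹ := by
    intro s hs
    have a : ‖u s‖ ≤ |s| := by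
      have := hLip.dist_le_mul (x + y * s) x
      rw [dist_eq_norm, dist_eq_norm] at this
      simp only [hu, norm_div, Complex.norm_real, Real.norm_of_nonneg hy.le]
      rw [div_le_iff₀ hy]
      simpa [abs_mul, abs_of_pos hy, mul_comm] using this
    have e : ‖v s‖ = 1 / (1 + s ^ 2) := by
      simp only [hv, Complex.norm_real]
      exact Real.norm_of_nonneg (by positivity)
    have hs' : 0 < |s| := abs_pos.2 hs
    rw [Pi.mul_apply, norm_mul, e]
    calc ‖u s‖ * (1 / (1 + s ^ 2)) ≤ |s| * (1 / |s| ^ 2) := by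
          gcongr
          rw [sq_abs]; linarith
      _ = |s|⁻¹ := by field_simp
  have lim : ∀ l : Filter ℝ, Tendsto (fun s => |s|) l atTop → (∀ᶠ s in l, s ≠ 0) →
      Tendsto (u * v) l (𝓝 0) := fun l hl hne =>
    squeeze_zero_norm' (hne.mono fun s hs => huv s hs) (tendsto_inv_atTop_zero.comp hl)
  have ibp := integral_mul_deriv_eq_deriv_mul (fun s _ => du s) (fun s _ => dv s) iuv' iu'v
    (lim _ tendsto_abs_atBot_atTop (eventually_ne_atBot 0))
    (lim _ tendsto_abs_atTop_atTop (eventually_ne_atTop 0))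
  have e1 : ∀ s : ℝ, u s * (2 * s / (1 + s ^ 2) ^ 2 : ℝ) = -(u s * v' s) := by
    intro s
    simp only [hv']; push_cast; ring
  have e2 : ∀ s : ℝ, u' s * v s = F (x + y * s + ε * Complex.I) / (s ^ 2 + 1 : ℝ) := by
    intro s
    simp only [hv, hu']; push_cast; ring
  change ∫ s : ℝ, u s * (2 * s / (1 + s ^ 2) ^ 2 : ℝ) = _
  simp_rw [e1]
  rw [integral_neg, ibp, sub_zero, zero_sub, neg_neg]
  simp_rw [e2]
  exact hp

/-- Letting ε → 0 expresses F(x + iy) through difference quotients of the boundary primitive B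
alone, so that its behaviour as y → 0 depends on the differentiability of B at x. -/
theorem integral_slope_boundary_primitive {F : ℂ → ℂ} (hF : DifferentiableOn ℂ F upperHalf)
    (h1 : ∀ z ∈ upperHalf, ‖F z‖ ≤ 1) {B : ℝ → ℂ}
    (hB : ∀ t, Tendsto (fun ε => linePrimitive F ε t) (𝓝[>] 0) (𝓝 (B t)))
    (x : ℝ) {y : ℝ} (hy : 0 < y) :
    ∫ s : ℝ, (B (x + y * s) - B x) / y * (2 * s / (1 + s ^ 2) ^ 2 : ℝ)
      = Real.pi * F (x + y * Complex.I) := by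
  have hmem : (x + y * Complex.I : ℂ) ∈ upperHalf := by simpa [upperHalf] using hy
  have l1 : Tendsto (fun ε : ℝ => Real.pi * F (x + y * Complex.I + ε * Complex.I)) (𝓝[>] 0)
      (𝓝 (Real.pi * F (x + y * Complex.I))) := by
    refine Tendsto.const_mul _ ?_
    exact (hF.continuousOn.continuousAt (isOpen_upperHalf.mem_nhds hmem)).tendsto.comp
      (tendsto_add_mul_I _ _ nhdsWithin_le_nhds)
  have l2 : Tendsto (fun ε : ℝ => ∫ s : ℝ,
      (linePrimitive F ε (x + y * s) - linePrimitive F ε x) / y * (2 * s / (1 + s ^ 2) ^ 2 : ℝ))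
      (𝓝[>] 0)
      (𝓝 (∫ s : ℝ, (B (x + y * s) - B x) / y * (2 * s / (1 + s ^ 2) ^ 2 : ℝ))) := by
    refine tendsto_integral_filter_of_dominated_convergence (fun s => 2 * (1 + s ^ 2)⁻¹)
      ?_ ?_ (integrable_inv_one_add_sq.const_mul 2) ?_
    · filter_upwards [self_mem_nhdsWithin] with ε hε
      have hc := (linePrimitive_lipschitz hF h1 hε).continuous
      have : Continuous fun s : ℝ => (linePrimitive F ε (x + y * s) - linePrimitive F ε x) / y
          * (2 * s / (1 + s ^ 2) ^ 2 : ℝ) := by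
        refine Continuous.mul (by fun_prop) (Complex.continuous_ofReal.comp ?_)
        exact Continuous.div (by fun_prop) (by fun_prop) fun s => by positivity
      exact this.aestronglyMeasurable
    · filter_upwards [self_mem_nhdsWithin] with ε hε
      refine Eventually.of_forall fun s => ?_
      rw [← div_eq_mul_inv]
      exact norm_slope_mul_le (linePrimitive_lipschitz hF h1 hε) x hy s
    · exact Eventually.of_forall fun s => (((hB _).sub (hB _)).div_const _).mul_const _
  refine tendsto_nhds_unique l2 (l1.congr' ?_)
  filter_upwards [self_mem_nhdsWithin] with ε hε
  exact (integral_slope_linePrimitive hF h1 x hy hε).symm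

/-- The difference quotients tend to s B'(x) under an integrable majorant. Only the existence of the
limit is needed, so the remaining integral is left unevaluated. -/
theorem tendsto_boundary_of_differentiableAt {F : ℂ → ℂ} (hF : DifferentiableOn ℂ F upperHalf)
    (h1 : ∀ z ∈ upperHalf, ‖F z‖ ≤ 1) {B : ℝ → ℂ} (hLip : LipschitzWith 1 B)
    (hB : ∀ t, Tendsto (fun ε => linePrimitive F ε t) (𝓝[>] 0) (𝓝 (B t)))
    {x : ℝ} (hx : DifferentiableAt ℝ B x) :
    ∃ c, Tendsto (fun y : ℝ => F (x + y * Complex.I)) (𝓝[>] 0) (𝓝 c) := by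
  have l : Tendsto (fun y : ℝ => ∫ s : ℝ, (B (x + y * s) - B x) / y
      * (2 * s / (1 + s ^ 2) ^ 2 : ℝ)) (𝓝[>] 0)
      (𝓝 (∫ s : ℝ, (s * deriv B x) * (2 * s / (1 + s ^ 2) ^ 2 : ℝ))) := by
    refine tendsto_integral_filter_of_dominated_convergence (fun s => 2 * (1 + s ^ 2)⁻¹)
      ?_ ?_ (integrable_inv_one_add_sq.const_mul 2) ?_
    · filter_upwards [self_mem_nhdsWithin] with y hy
      have hc := hLip.continuous
      have : Continuous fun s : ℝ => (B (x + y * s) - B x) / y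
          * (2 * s / (1 + s ^ 2) ^ 2 : ℝ) := by
        refine Continuous.mul (by fun_prop) (Complex.continuous_ofReal.comp ?_)
        exact Continuous.div (by fun_prop) (by fun_prop) fun s => by positivity
      exact this.aestronglyMeasurable
    · filter_upwards [self_mem_nhdsWithin] with y hy
      refine Eventually.of_forall fun s => ?_
      rw [← div_eq_mul_inv]
      exact norm_slope_mul_le hLip x hy s
    · refine Eventually.of_forall fun s => Tendsto.mul_const _ ?_
      have hg : HasDerivAt (fun y : ℝ => B (x + y * s)) ((s : ℂ) * deriv B x) 0 := by
        have b : HasDerivAt (fun y : ℝ => x + y * s) s 0 := by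
          simpa using ((hasDerivAt_id (0 : ℝ)).mul_const s).const_add x
        have a : HasDerivAt B (deriv B x) (x + 0 * s) := by simpa using hx.hasDerivAt
        simpa [Function.comp_def] using a.scomp 0 b
      have := hg.tendsto_slope_zero_right
      refine this.congr fun y => ?_
      simp [Complex.real_smul, div_eq_inv_mul]
  refine ⟨_, (l.const_mul (Real.pi : ℂ)⁻¹).congr' ?_⟩
  filter_upwards [self_mem_nhdsWithin] with y hy
  rw [integral_slope_boundary_primitive hF h1 hB x hy]
  have : (Real.pi : ℂ) ≠ 0 := by exact_mod_cast Real.pi_ne_zero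
  field_simp

theorem tendsto_inv_nat_nhdsGT_zero :
    Tendsto (fun n : ℕ => 1 / ((n : ℝ) + 1)) atTop (𝓝[>] 0) :=
  tendsto_nhdsWithin_iff.2 ⟨tendsto_one_div_add_atTop_nhds_zero_nat,
    Eventually.of_forall fun n => Set.mem_Ioi.2 (by positivity)⟩

/-- **Fatou's theorem** for bounded analytic functions on the half-plane. -/
theorem exists_hasBoundaryValues_of_bounded {F : ℂ → ℂ} (hF : DifferentiableOn ℂ F upperHalf)
    (h1 : ∀ z ∈ upperHalf, ‖F z‖ ≤ 1) :
    ∃ β : Lp ℂ ∞ (volume : Measure ℝ), HasBoundaryValues F β := by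
  obtain ⟨B, hLip, hB⟩ := exists_boundary_primitive hF h1
  -- A Lipschitz function on the line is differentiable almost everywhere.
  have hae : ∀ᵐ x : ℝ, ∃ c, Tendsto (fun y : ℝ => F (x + y * Complex.I)) (𝓝[>] 0) (𝓝 c) := by
    filter_upwards [hLip.ae_differentiableAt_real] with x hx
    exact tendsto_boundary_of_differentiableAt hF h1 hLip hB hx
  set β : ℝ → ℂ := fun x => limUnder (𝓝[>] 0) fun y : ℝ => F (x + y * Complex.I) with hβ
  have hβ' : HasBoundaryValues F β := hae.mono fun x hx => tendsto_nhds_limUnder hx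
  have hm : AEStronglyMeasurable β volume := by
    refine aestronglyMeasurable_of_tendsto_ae atTop
      (f := fun (n : ℕ) (x : ℝ) => F (x + (1 / ((n : ℝ) + 1) : ℝ) * Complex.I))
      (fun n => aestronglyMeasurable_line hF (by positivity)) ?_
    filter_upwards [hβ'] with x hx
    exact hx.comp tendsto_inv_nat_nhdsGT_zero
  have hb : MemLp β ∞ volume := by
    refine memLp_top_of_bound hm 1 ?_
    filter_upwards [hβ'] with x hx
    refine le_of_tendsto hx.norm ?_
    filter_upwards [self_mem_nhdsWithin] with t ht
    exact h1 _ (by simpa [upperHalf] using ht)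
  refine ⟨hb.toLp β, ?_⟩
  filter_upwards [hβ', hb.coeFn_toLp] with x hx e
  rwa [e]

theorem HInftyBall.hasBoundaryValues_bdry (b : HInftyBall) : HasBoundaryValues b b.bdry := by
  have h := exists_hasBoundaryValues_of_bounded b.differentiableOn b.norm_le_one
  have e : b.bdry = h.choose := by simp only [bdry]; rw [dif_pos h]
  rw [e]
  exact h.choose_spec

/-! ### Boundedness of H² functions away from the real line. -/

/-- This is the mean value property on a circle; the angles run over (-π, π) to match polar
coordinates. -/
theorem two_pi_mul_enorm_le_lintegral_circle {F : ℂ → ℂ} (hF : DifferentiableOn ℂ F upperHalf)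
    {w : ℂ} {r : ℝ} (hr : 0 < r) (hrw : r < w.im) :
    ENNReal.ofReal (2 * Real.pi) * ‖F w‖ₑ
      ≤ ∫⁻ θ in Set.Ioo (-Real.pi) Real.pi, ‖F (circleMap w r θ)‖ₑ := by
  have hsub : Metric.closedBall w |r| ⊆ upperHalf := by
    intro z hz
    rw [abs_of_pos hr, mem_closedBall_iff_norm] at hz
    have := (Complex.abs_im_le_norm (z - w)).trans hz
    rw [Complex.sub_im, abs_le] at this
    simp only [upperHalf, Set.mem_ofPred_eq]
    linarith
  have h := (hF.diffContOnCl_ball hsub).circleAverage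
  rw [Real.circleAverage_def] at h
  have hper : Function.Periodic (fun θ => F (circleMap w r θ)) (2 * Real.pi) := fun θ => by
    simp only [periodic_circleMap w r θ]
  have hshift := hper.intervalIntegral_add_eq 0 (-Real.pi)
  rw [zero_add, show -Real.pi + 2 * Real.pi = Real.pi by ring] at hshift
  rw [hshift, inv_smul_eq_iff₀ (by positivity),
    intervalIntegral.integral_of_le (by linarith [Real.pi_pos])] at h
  have h2 := congrArg enorm h
  rw [enorm_smul, Real.enorm_of_nonneg (by positivity)] at h2
  rw [← h2, Measure.restrict_congr_set Ioo_ae_eq_Ioc]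
  exact enorm_integral_le_lintegral_enorm _

theorem lintegral_Icc_enorm_le {h : ℝ → ℂ} (hm : AEStronglyMeasurable h volume) {C : ℝ≥0}
    (hC : eLpNorm h 2 volume ≤ C) (a R : ℝ) :
    ∫⁻ x in Set.Icc (-R) R, ‖h (a + x)‖ₑ ≤ C * ENNReal.ofReal (2 * R) ^ (1 / 2 : ℝ) := by
  have hmp : MeasurePreserving (fun x : ℝ => a + x) volume volume :=
    measurePreserving_add_left volume a
  have hm' : AEStronglyMeasurable (fun x => h (a + x)) volume := hm.comp_measurePreserving hmp
  have h1 := eLpNorm_le_eLpNorm_mul_rpow_measure_univ (μ := volume.restrict (Set.Icc (-R) R))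
    (f := fun x => h (a + x)) (p := 1) (q := 2) (by norm_num) hm'.restrict
  rw [eLpNorm_one_eq_lintegral_enorm] at h1
  refine h1.trans (mul_le_mul' ?_ (le_of_eq ?_))
  · refine (eLpNorm_mono_measure _ Measure.restrict_le_self).trans ?_
    exact (eLpNorm_comp_measurePreserving hm hmp).le.trans hC
  · rw [Measure.restrict_apply_univ, Real.volume_Icc]
    rw [show R - -R = 2 * R by ring, show (1 / ENNReal.toReal 1 - 1 / ENNReal.toReal 2 : ℝ)
      = 1 / 2 by norm_num]

/-- Circle means are averaged over radii to bound |F(w)| by an area integral over a square around w,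
whose horizontal slices are controlled by the H² norm and Cauchy–Schwarz. Taking half-side ε/2 keeps
the square in the half-plane. -/
theorem MemHardyTwo.exists_bound {F : ℂ → ℂ} (hF : MemHardyTwo F) {ε : ℝ} (hε : 0 < ε) :
    ∃ M : ℝ, ∀ z : ℂ, ε ≤ z.im → ‖F z‖ ≤ M := by
  obtain ⟨hd, C, hC⟩ := hF
  classical
  set R := ε / 2 with hR
  have hR0 : 0 < R := by positivity
  -- The values of F off the half-plane are arbitrary; extension by 0 makes it measurable.
  set F₀ : ℂ → ℂ := upperHalf.piecewise F 0 with hF₀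
  have hF₀m : Measurable F₀ :=
    hd.continuousOn.measurable_piecewise continuousOn_const isOpen_upperHalf.measurableSet
  have hF₀v : ∀ z ∈ upperHalf, F₀ z = F z := fun z hz => Set.piecewise_eq_of_mem _ _ _ hz
  set A : ℝ≥0∞ := ∫⁻ _ in Set.Icc (-R) R, C * ENNReal.ofReal (2 * R) ^ (1 / 2 : ℝ) with hA
  -- Radii are restricted to (R/2, R): the Jacobian r is at least R/2, the angles give 2π, and the
  -- radial interval has length R/2.
  set K : ℝ≥0∞ := ENNReal.ofReal (R / 2) * ENNReal.ofReal (2 * Real.pi)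
    * ENNReal.ofReal (R / 2) with hK
  have hAtop : A ≠ ∞ := by
    rw [hA, setLIntegral_const, Real.volume_Icc]
    finiteness
  have hK0 : K ≠ 0 := by
    simp only [hK, ne_eq, mul_eq_zero, ENNReal.ofReal_eq_zero, not_or, not_le]
    exact ⟨⟨by positivity, by positivity⟩, by positivity⟩
  have key : ∀ w : ℂ, ε ≤ w.im → K * ‖F w‖ₑ ≤ A := by
    intro w hw
    set f : ℝ × ℝ → ℝ≥0∞ := fun p => ‖F₀ (w + (p.1 + p.2 * Complex.I))‖ₑ with hf
    have hfm : Measurable f := by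
      refine (hF₀m.comp ?_).enorm
      fun_prop
    set Q : Set (ℝ × ℝ) := Set.Icc (-R) R ×ˢ Set.Icc (-R) R with hQ
    have hQm : MeasurableSet Q := measurableSet_Icc.prod measurableSet_Icc
    have hupper : ∫⁻ p, Q.indicator f p ≤ A := by
      rw [lintegral_indicator hQm, hQ, Measure.volume_eq_prod, ← Measure.prod_restrict,
        lintegral_prod_symm _ hfm.aemeasurable]
      refine setLIntegral_mono' measurableSet_Icc fun y hy => ?_
      have hy' : 0 < w.im + y := by linarith [hy.1]
      refine le_trans (le_of_eq (lintegral_congr fun x => ?_)) (lintegral_Icc_enorm_le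
        (aestronglyMeasurable_line hd hy') (hC _ hy') w.re R)
      have e : w + (x + y * Complex.I) = (w.re + x : ℝ) + (w.im + y : ℝ) * Complex.I := by
        apply Complex.ext <;> simp
      simp only [hf]
      rw [e, hF₀v _ (by simpa [upperHalf] using hy')]
    have hlower : K * ‖F w‖ₑ ≤ ∫⁻ p in polarCoord.target,
        ENNReal.ofReal p.1 • Q.indicator f (polarCoord.symm p) := by
      have hS : Set.Ioo (R / 2) R ×ˢ Set.Ioo (-Real.pi) Real.pi ⊆ polarCoord.target := by
        rw [polarCoord_target]
        exact Set.prod_mono (fun r hr => Set.mem_Ioi.2 ((half_pos hR0).trans hr.1)) subset_rfl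
      refine le_trans ?_ (lintegral_mono_set hS)
      have hmeas : Measurable fun p : ℝ × ℝ =>
          ENNReal.ofReal p.1 • Q.indicator f (polarCoord.symm p) :=
        (ENNReal.measurable_ofReal.comp measurable_fst).mul
          ((hfm.indicator hQm).comp continuous_polarCoord_symm.measurable)
      rw [Measure.volume_eq_prod, ← Measure.prod_restrict, lintegral_prod _ hmeas.aemeasurable]
      have hr : ∀ r ∈ Set.Ioo (R / 2) R,
          ENNReal.ofReal (R / 2) * (ENNReal.ofReal (2 * Real.pi) * ‖F w‖ₑ)
          ≤ ∫⁻ θ in Set.Ioo (-Real.pi) Real.pi,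
            ENNReal.ofReal r • Q.indicator f (polarCoord.symm (r, θ)) := by
        intro r hr
        have hr0 : 0 < r := (half_pos hR0).trans hr.1
        have hrw : r < w.im := by linarith [hr.2]
        have e : ∀ θ, Q.indicator f (polarCoord.symm (r, θ)) = ‖F (circleMap w r θ)‖ₑ := by
          intro θ
          have hmem : polarCoord.symm (r, θ) ∈ Q := by
            have h1 := abs_le.1 (Real.abs_cos_le_one θ)
            have h2 := abs_le.1 (Real.abs_sin_le_one θ)
            simp only [polarCoord_symm_apply, hQ, Set.mem_prod, Set.mem_Icc]
            refine ⟨⟨?_, ?_⟩, ?_, ?_⟩ <;> nlinarith [hr.2]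
          rw [Set.indicator_of_mem hmem]
          simp only [hf, polarCoord_symm_apply]
          have e1 : w + (((r * Real.cos θ : ℝ) : ℂ) + ((r * Real.sin θ : ℝ) : ℂ) * Complex.I)
              = circleMap w r θ := by
            rw [circleMap, Complex.exp_mul_I]
            push_cast
            ring
          rw [e1, hF₀v]
          have := Complex.abs_im_le_norm (circleMap w r θ - w)
          rw [circleMap_sub_center, norm_circleMap_zero, abs_of_pos hr0,
            ← circleMap_sub_center w r θ, Complex.sub_im, abs_le] at this
          simp only [upperHalf, Set.mem_ofPred_eq]
          linarith
        simp_rw [e, smul_eq_mul]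
        rw [lintegral_const_mul' _ _ ENNReal.ofReal_ne_top]
        exact mul_le_mul' (ENNReal.ofReal_le_ofReal hr.1.le)
          (two_pi_mul_enorm_le_lintegral_circle hd hr0 hrw)
      refine le_trans (le_of_eq ?_) (setLIntegral_mono' measurableSet_Ioo hr)
      rw [setLIntegral_const, Real.volume_Ioo, show R - R / 2 = R / 2 by ring, hK]
      ring
    calc K * ‖F w‖ₑ ≤ _ := hlower
      _ = ∫⁻ p, Q.indicator f p := lintegral_comp_polarCoord_symm _
      _ ≤ A := hupper
  refine ⟨(A / K).toReal, fun z hz => ?_⟩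
  have h1 : ‖F z‖ₑ ≤ A / K := by
    rw [ENNReal.le_div_iff_mul_le (Or.inl hK0) (Or.inr hAtop), mul_comm]
    exact key z hz
  rw [← toReal_enorm]
  exact ENNReal.toReal_mono (ENNReal.div_ne_top hAtop hK0) h1

/-! ### Cauchy's formula for H² and its derivatives. -/

theorem norm_ofReal_sub_lower' {w : ℂ} (hw : w.im ≠ 0) :
    ∃ c : ℝ, 0 < c ∧ ∀ t : ℝ, c * (1 + |t|) ≤ ‖(t : ℂ) - w‖ := by
  rcases hw.lt_or_gt with h | h
  · obtain ⟨c, hc, hcw⟩ := norm_sub_conj_lower (w := conj w) (by simpa using h)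
    exact ⟨c, hc, fun t => by simpa using hcw t (by simp)⟩
  · exact norm_ofReal_sub_lower h

theorem continuous_inv_sub_pow {w : ℂ} (hw : w.im ≠ 0) (m : ℕ) :
    Continuous fun t : ℝ => 1 / ((t : ℂ) - w) ^ (m + 1) :=
  continuous_const.div (by fun_prop) fun t => pow_ne_zero _ (ofReal_sub_ne_zero hw t)

theorem memLp_inv_sub_pow {w : ℂ} (hw : w.im ≠ 0) (m : ℕ) :
    MemLp (fun t : ℝ => 1 / ((t : ℂ) - w) ^ (m + 1)) 2 volume := by
  obtain ⟨c, hc, hcw⟩ := norm_ofReal_sub_lower' hw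
  have hcont := continuous_inv_sub_pow hw m
  rw [memLp_two_iff_integrable_sq_norm hcont.aestronglyMeasurable]
  refine (integrable_inv_one_add_sq.const_mul (1 / c ^ (m + 1)) |>.const_mul
    (1 / c ^ (m + 1))).mono' (hcont.norm.pow 2).aestronglyMeasurable
    (Eventually.of_forall fun t => ?_)
  have h0 : 0 ≤ |t| := abs_nonneg t
  have h1 : ‖1 / ((t : ℂ) - w) ^ (m + 1)‖ ≤ 1 / (c ^ (m + 1) * (1 + |t|)) := by
    rw [norm_div, norm_one, norm_pow]
    refine div_le_div_of_nonneg_left zero_le_one (by positivity) ?_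
    calc c ^ (m + 1) * (1 + |t|) ≤ c ^ (m + 1) * (1 + |t|) ^ (m + 1) := by
          gcongr
          exact le_self_pow₀ (by linarith) (by omega)
      _ = (c * (1 + |t|)) ^ (m + 1) := by rw [mul_pow]
      _ ≤ _ := by gcongr; exact hcw t
  rw [Real.norm_of_nonneg (by positivity)]
  calc ‖1 / ((t : ℂ) - w) ^ (m + 1)‖ ^ 2 ≤ (1 / (c ^ (m + 1) * (1 + |t|))) ^ 2 := by gcongr
    _ = 1 / c ^ (m + 1) * (1 / c ^ (m + 1) * (1 / (1 + |t|) ^ 2)) := by field_simp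
    _ ≤ 1 / c ^ (m + 1) * (1 / c ^ (m + 1) * (1 + t ^ 2)⁻¹) := by
        rw [← one_div]
        gcongr
        exact one_add_sq_le_sq t

theorem integrable_mul_of_memLp_two {μ : Measure ℝ} {u v : ℝ → ℂ} (hu : MemLp u 2 μ)
    (hv : MemLp v 2 μ) : Integrable (fun t => u t * v t) μ := hu.integrable_mul hv

theorem MemHardyTwo.memLp_line {F : ℂ → ℂ} (hF : MemHardyTwo F) {y : ℝ} (hy : 0 < y) :
    MemLp (fun x : ℝ => F (x + y * Complex.I)) 2 volume := by
  obtain ⟨hd, C, hC⟩ := hF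
  exact ⟨aestronglyMeasurable_line hd hy, (hC y hy).trans_lt ENNReal.coe_lt_top⟩

theorem MemHardyTwo.cauchy_line {F : ℂ → ℂ} (hF : MemHardyTwo F) {w : ℂ} (hw : 0 < w.im)
    {ε : ℝ} (hε : 0 < ε) :
    ∫ t : ℝ, F (t + ε * Complex.I) * (1 / (t - w) ^ (0 + 1))
      = 2 * Real.pi * Complex.I * F (w + ε * Complex.I) := by
  obtain ⟨M, hM⟩ := hF.exists_bound hε
  have hint := integrable_mul_of_memLp_two (hF.memLp_line hε) (memLp_inv_sub_pow hw.ne' 0)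
  have hmem : ∀ z : ℂ, 0 ≤ z.im → z + ε * Complex.I ∈ upperHalf := fun z hz => by
    simp only [upperHalf, Set.mem_ofPred_eq, Complex.add_im, Complex.mul_im, Complex.ofReal_re,
      Complex.I_im, Complex.ofReal_im, Complex.I_re]
    linarith
  have hM' : ∀ z : ℂ, 0 ≤ z.im → ‖F (z + ε * Complex.I)‖ ≤ M := fun z hz =>
    hM _ (by simpa using hz)
  have hM0 : 0 ≤ M := (norm_nonneg _).trans (hM' 0 (by simp))
  -- F(· + iε) is bounded but need not satisfy the decay estimate of `cauchy_formula`. The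
  -- multipliers a / (z - ā) with a = (N + 1)i supply it; they have modulus at most 1 and tend to 1
  -- pointwise, so dominated convergence removes them.
  set a : ℕ → ℂ := fun N => ((N : ℝ) + 1 : ℝ) * Complex.I with ha
  have hai : ∀ N, (a N).im = (N : ℝ) + 1 := fun N => by simp [ha]
  have hapos : ∀ N, 0 < (a N).im := fun N => by rw [hai]; positivity
  have han : ∀ N, ‖a N‖ = (a N).im := fun N => by
    rw [hai]; simp only [ha, norm_mul, Complex.norm_real, Complex.norm_I, mul_one]
    exact Real.norm_of_nonneg (by positivity)
  set m : ℕ → ℂ → ℂ := fun N z => a N / (z - conj (a N)) with hm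
  have hne : ∀ N, ∀ z : ℂ, 0 ≤ z.im → z - conj (a N) ≠ 0 := fun N z hz =>
    norm_pos_iff.1 ((hapos N).trans_le (im_le_norm_sub_conj hz))
  have hm1 : ∀ N, ∀ z : ℂ, 0 ≤ z.im → ‖m N z‖ ≤ 1 := fun N z hz => by
    simp only [hm]
    rw [norm_div, han]
    exact div_le_one_of_le₀ (im_le_norm_sub_conj hz) (norm_nonneg _)
  have hmlim : ∀ z : ℂ, 0 ≤ z.im → Tendsto (fun N => m N z) atTop (𝓝 1) := by
    intro z hz
    have h1 : Tendsto (fun N : ℕ => ((1 / ((N : ℝ) + 1) : ℝ) : ℂ)) atTop (𝓝 0) := by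
      have := (Complex.continuous_ofReal.tendsto 0).comp
        (tendsto_one_div_add_atTop_nhds_zero_nat (𝕜 := ℝ))
      rwa [Complex.ofReal_zero] at this
    have h2 : Tendsto (fun N : ℕ => Complex.I / (((1 / ((N : ℝ) + 1) : ℝ) : ℂ) * z + Complex.I))
        atTop (𝓝 (Complex.I / (0 * z + Complex.I))) :=
      tendsto_const_nhds.div ((h1.mul_const z).add_const _) (by simp)
    rw [zero_mul, zero_add, div_self Complex.I_ne_zero] at h2
    refine h2.congr fun N => ?_
    have hN : (((N : ℝ) + 1 : ℝ) : ℂ) ≠ 0 := by exact_mod_cast Nat.succ_ne_zero N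
    have hnz := hne N z hz
    have e : z - conj (a N) = ((N : ℝ) + 1 : ℝ) * ((((1 / ((N : ℝ) + 1) : ℝ) : ℂ)) * z
        + Complex.I) := by
      simp only [ha, map_mul, Complex.conj_ofReal, Complex.conj_I, Complex.ofReal_div,
        Complex.ofReal_one]
      field_simp
      ring
    simp only [hm]
    rw [e] at hnz ⊢
    have hnz' := right_ne_zero_of_mul hnz
    simp only [ha]
    rw [mul_div_mul_left _ _ hN]
  have hcauchy : ∀ N, ∫ t : ℝ, F (t + ε * Complex.I) * (1 / (t - w) ^ (0 + 1)) * m N t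
      = 2 * Real.pi * Complex.I * (F (w + ε * Complex.I) * m N w) := by
    intro N
    obtain ⟨c, hc, hcw⟩ := norm_sub_conj_lower (hapos N)
    rw [← cauchy_formula (Φ := fun z => F (z + ε * Complex.I) * m N z) (C := M * ‖a N‖ / c)
      ((hF.1.continuousOn.comp (by fun_prop) fun z hz => hmem z hz).mul
        (continuousOn_const.div (by fun_prop) fun z hz => hne N z hz))
      ((hF.1.comp (by fun_prop) fun z hz => hmem z (le_of_lt hz)).mul
        ((differentiableOn_const _).div (by fun_prop) fun z hz => hne N z (le_of_lt hz)))
      (fun z hz => ?_) hw]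
    · refine integral_congr_ae (Eventually.of_forall fun t => ?_)
      simp only [zero_add, pow_one]
      ring
    · simp only [hm]
      rw [norm_mul, norm_div, mul_div_assoc', div_div]
      refine div_le_div₀ (by positivity) ?_ (by positivity) (hcw z hz)
      gcongr
      exact hM' z hz
  have l1 : Tendsto (fun N => ∫ t : ℝ, F (t + ε * Complex.I) * (1 / (t - w) ^ (0 + 1)) * m N t)
      atTop (𝓝 (∫ t : ℝ, F (t + ε * Complex.I) * (1 / (t - w) ^ (0 + 1)) * 1)) := by
    refine tendsto_integral_of_dominated_convergence _ (fun N => ?_) hint.norm (fun N => ?_) ?_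
    · refine hint.aestronglyMeasurable.mul (Continuous.aestronglyMeasurable ?_)
      exact continuous_const.div (by fun_prop) fun t : ℝ => hne N t (by simp)
    · refine Eventually.of_forall fun t => ?_
      rw [norm_mul]
      exact mul_le_of_le_one_right (norm_nonneg _) (hm1 N t (by simp))
    · exact Eventually.of_forall fun t => (hmlim t (by simp)).const_mul _
  have l2 := ((hmlim w hw.le).const_mul (F (w + ε * Complex.I))).const_mul
    (2 * Real.pi * Complex.I)
  simp_rw [hcauchy] at l1
  have := tendsto_nhds_unique l1 l2
  simpa using this

/-- Bounded sequences in `L²` that converge almost everywhere converge weakly. -/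
theorem tendsto_integral_mul_of_bounded_of_ae {h : ℕ → ℝ → ℂ} {u k : ℝ → ℂ} {C : ℝ≥0}
    (hh : ∀ n, AEStronglyMeasurable (h n) volume) (hC : ∀ n, eLpNorm (h n) 2 volume ≤ C)
    (hu : MemLp u 2 volume) (hk : MemLp k 2 volume)
    (hlim : ∀ᵐ t, Tendsto (fun n => h n t) atTop (𝓝 (u t))) :
    Tendsto (fun n => ∫ t, h n t * k t) atTop (𝓝 (∫ t, u t * k t)) := by
  have hhL : ∀ n, MemLp (h n) 2 volume := fun n => ⟨hh n, (hC n).trans_lt ENNReal.coe_lt_top⟩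
  have hdL : ∀ n, MemLp (fun t => h n t - u t) 2 volume := fun n => (hhL n).sub hu
  obtain ⟨D, hD0, hD⟩ : ∃ D : ℝ, 0 ≤ D ∧ ∀ n, ∫ t, ‖h n t - u t‖ ^ 2 ≤ D := by
    refine ⟨((C + eLpNorm u 2 volume) ^ 2).toReal, ENNReal.toReal_nonneg, fun n => ?_⟩
    have h1 : eLpNorm (fun t => h n t - u t) 2 volume ≤ C + eLpNorm u 2 volume :=
      (eLpNorm_sub_le (hh n) hu.1 (by norm_num)).trans (add_le_add_left (hC n) _)
    have h2 : ENNReal.ofReal (∫ t, ‖h n t - u t‖ ^ 2)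
        = eLpNorm (fun t => h n t - u t) 2 volume ^ 2 := by
      rw [ofReal_integral_eq_lintegral_ofReal ((hdL n).integrable_norm_pow (by norm_num))
        (Eventually.of_forall fun t => by positivity)]
      rw [eLpNorm_eq_lintegral_rpow_enorm_toReal (by norm_num) (by norm_num)]
      simp only [ENNReal.toReal_ofNat, ENNReal.rpow_ofNat, one_div]
      rw [← ENNReal.rpow_ofNat, ← ENNReal.rpow_mul]
      norm_num
    have hu' := hu.2.ne
    have h3 : (C + eLpNorm u 2 volume) ^ 2 ≠ ∞ := by finiteness
    rw [← ENNReal.ofReal_le_iff_le_toReal h3, h2]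
    gcongr
  have hdk : ∀ n, Integrable (fun t => (h n t - u t) * k t) := fun n =>
    integrable_mul_of_memLp_two (hdL n) hk
  have hk2 : Integrable fun t => ‖k t‖ ^ 2 := hk.integrable_norm_pow (by norm_num)
  have main : Tendsto (fun n => ∫ t, ‖(h n t - u t) * k t‖) atTop (𝓝 0) := by
    rw [Metric.tendsto_atTop]
    intro e he
    -- With d = |h n - u|, one has d|k| ≤ min(d, |k|/η)|k| + ηd², since |k| ≤ ηd when d exceeds
    -- |k|/η. The first term is dominated by |k|²/η and the second integrates to at most ηD ≤ e/2;
    -- the summand 1 allows D = 0.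
    set η := e / (2 * (D + 1)) with hη
    have hη0 : 0 < η := by positivity
    have l1 : Tendsto (fun n => ∫ t, min ‖h n t - u t‖ (‖k t‖ * η⁻¹) * ‖k t‖) atTop
        (𝓝 (∫ _ : ℝ, (0 : ℝ))) := by
      refine tendsto_integral_of_dominated_convergence (fun t => η⁻¹ * ‖k t‖ ^ 2) (fun n => ?_)
        (hk2.const_mul _) (fun n => Eventually.of_forall fun t => ?_) ?_
      · exact ((hdL n).1.norm.inf (hk.1.norm.mul_const η⁻¹)).mul hk.1.norm
      · rw [Real.norm_of_nonneg (by positivity)]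
        calc min ‖h n t - u t‖ (‖k t‖ * η⁻¹) * ‖k t‖ ≤ ‖k t‖ * η⁻¹ * ‖k t‖ := by
              gcongr; exact min_le_right _ _
          _ = _ := by ring
      · filter_upwards [hlim] with t ht
        have : Tendsto (fun n => ‖h n t - u t‖) atTop (𝓝 0) := by
          simpa using (ht.sub_const (u t)).norm
        have h0 := (this.min (tendsto_const_nhds (x := ‖k t‖ * η⁻¹))).mul_const ‖k t‖
        rwa [min_eq_left (by positivity), zero_mul] at h0
    rw [integral_zero] at l1
    obtain ⟨N, hN⟩ := (Metric.tendsto_atTop.1 l1) (e / 2) (by positivity)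
    refine ⟨N, fun n hn => ?_⟩
    have h1 := hN n hn
    rw [Real.dist_eq, sub_zero] at h1 ⊢
    rw [abs_of_nonneg (integral_nonneg fun t => norm_nonneg _)]
    have imin : Integrable fun t => min ‖h n t - u t‖ (‖k t‖ * η⁻¹) * ‖k t‖ := by
      refine (hk2.const_mul η⁻¹).mono'
        (((hdL n).1.norm.inf (hk.1.norm.mul_const η⁻¹)).mul hk.1.norm)
        (Eventually.of_forall fun t => ?_)
      rw [Real.norm_of_nonneg (by positivity)]
      calc min ‖h n t - u t‖ (‖k t‖ * η⁻¹) * ‖k t‖ ≤ ‖k t‖ * η⁻¹ * ‖k t‖ := by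
            gcongr; exact min_le_right _ _
        _ = _ := by ring
    have isq := ((hdL n).integrable_norm_pow (p := 2) (by norm_num)).const_mul η
    have hle : ∫ t, ‖(h n t - u t) * k t‖ ≤
        (∫ t, min ‖h n t - u t‖ (‖k t‖ * η⁻¹) * ‖k t‖) + ∫ t, η * ‖h n t - u t‖ ^ 2 := by
      rw [← integral_add imin isq]
      refine integral_mono (hdk n).norm (imin.add isq) fun t => ?_
      simp only [norm_mul]
      have hx := norm_nonneg (h n t - u t)
      have hy := norm_nonneg (k t)
      rcases le_total ‖h n t - u t‖ (‖k t‖ * η⁻¹) with hc | hc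
      · rw [min_eq_left hc]
        nlinarith [mul_nonneg hη0.le (sq_nonneg ‖h n t - u t‖)]
      · rw [min_eq_right hc]
        rw [← div_eq_mul_inv, div_le_iff₀ hη0] at hc
        have : 0 ≤ ‖k t‖ * η⁻¹ * ‖k t‖ := by positivity
        nlinarith
    rw [integral_const_mul] at hle
    have h2 : η * ∫ t, ‖h n t - u t‖ ^ 2 ≤ e / 2 := by
      calc η * ∫ t, ‖h n t - u t‖ ^ 2 ≤ η * (D + 1) := by
            gcongr; linarith [hD n]
        _ = e / 2 := by rw [hη]; field_simp
    linarith [le_abs_self (∫ t, min ‖h n t - u t‖ (‖k t‖ * η⁻¹) * ‖k t‖)]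
  rw [tendsto_iff_norm_sub_tendsto_zero]
  refine squeeze_zero (fun n => norm_nonneg _) (fun n => ?_) main
  rw [← integral_sub (integrable_mul_of_memLp_two (hhL n) hk) (integrable_mul_of_memLp_two hu hk)]
  simp_rw [← sub_mul]
  exact norm_integral_le_integral_norm _

/-- Cauchy's formula for functions in `H²` in terms of the boundary values. -/
theorem MemHardyTwo.cauchy_boundary {F : ℂ → ℂ} (hF : MemHardyTwo F) {u : ℝ → ℂ}
    (hu : MemLp u 2 volume) (hFu : HasBoundaryValues F u) {w : ℂ} (hw : 0 < w.im) :
    ∫ t : ℝ, u t * (1 / (t - w) ^ (0 + 1)) = 2 * Real.pi * Complex.I * F w := by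
  obtain ⟨C, hC⟩ := hF.2
  have hpos : ∀ n : ℕ, (0 : ℝ) < 1 / ((n : ℝ) + 1) := fun n => by positivity
  -- The traces at heights 1/(n + 1) are bounded in L² and converge almost everywhere to u, hence
  -- weakly.
  have l1 := tendsto_integral_mul_of_bounded_of_ae
    (h := fun (n : ℕ) (t : ℝ) => F (t + (1 / ((n : ℝ) + 1) : ℝ) * Complex.I))
    (fun n => aestronglyMeasurable_line hF.1 (hpos n)) (fun n => hC _ (hpos n)) hu
    (memLp_inv_sub_pow hw.ne' 0) (hFu.mono fun t ht => ht.comp tendsto_inv_nat_nhdsGT_zero)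
  simp_rw [hF.cauchy_line hw (hpos _)] at l1
  refine tendsto_nhds_unique l1 (Tendsto.const_mul _ ?_)
  exact (hF.1.continuousOn.continuousAt (isOpen_upperHalf.mem_nhds hw)).tendsto.comp
    ((tendsto_add_mul_I w _ nhdsWithin_le_nhds).comp tendsto_inv_nat_nhdsGT_zero)

theorem hasDerivAt_inv_sub_pow (t : ℝ) {x : ℂ} (hx : (t : ℂ) - x ≠ 0) (m : ℕ) :
    HasDerivAt (fun x : ℂ => 1 / ((t : ℂ) - x) ^ (m + 1))
      ((m + 1) * (1 / ((t : ℂ) - x) ^ (m + 1 + 1))) x := by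
  have h := (((hasDerivAt_id x).const_sub (t : ℂ)).pow (m + 1)).inv (pow_ne_zero _ hx)
  simp only [one_div]
  refine h.congr_deriv ?_
  simp only [Pi.pow_apply, id]
  push_cast
  field_simp
  ring

theorem hasDerivAt_cauchyIntegral {u : ℝ → ℂ} (hu : MemLp u 2 volume) {w : ℂ} (hw : 0 < w.im)
    (m : ℕ) :
    HasDerivAt (fun x : ℂ => ∫ t : ℝ, u t * (1 / (t - x) ^ (m + 1)))
      ((m + 1) * ∫ t : ℝ, u t * (1 / (t - w) ^ (m + 1 + 1))) w := by
  have hball : ∀ x ∈ Metric.ball w (w.im / 2), 0 < x.im := by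
    intro x hx
    rw [mem_ball_iff_norm] at hx
    have := (Complex.abs_im_le_norm (x - w)).trans_lt hx
    rw [Complex.sub_im, abs_lt] at this
    linarith
  -- Since |t - w| ≥ Im w, moving the pole by less than Im w / 2 at most halves the distance to t;
  -- this gives the factor 2^(m + 2) in the majorant.
  have hlow : ∀ x ∈ Metric.ball w (w.im / 2), ∀ t : ℝ, ‖(t : ℂ) - w‖ / 2 ≤ ‖(t : ℂ) - x‖ := by
    intro x hx t
    rw [mem_ball_iff_norm] at hx
    have h1 : w.im ≤ ‖(t : ℂ) - w‖ := im_le_norm_sub (by simp)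
    have h2 : ‖(t : ℂ) - w‖ ≤ ‖(t : ℂ) - x‖ + ‖x - w‖ := by
      simpa using norm_add_le ((t : ℂ) - x) (x - w)
    linarith
  have hmeas : ∀ (x : ℂ) (j : ℕ), 0 < x.im →
      AEStronglyMeasurable (fun t : ℝ => u t * (1 / (t - x) ^ (j + 1))) volume := fun x j hx =>
    hu.1.mul (continuous_inv_sub_pow hx.ne' j).aestronglyMeasurable
  have hint := fun j => integrable_mul_of_memLp_two hu (memLp_inv_sub_pow hw.ne' j)
  have key := hasDerivAt_integral_of_dominated_loc_of_deriv_le (μ := (volume : Measure ℝ))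
    (F := fun x t => u t * (1 / ((t : ℂ) - x) ^ (m + 1)))
    (F' := fun x t => u t * ((m + 1) * (1 / ((t : ℂ) - x) ^ (m + 1 + 1))))
    (bound := fun t => ((m + 1) * 2 ^ (m + 1 + 1)) * ‖u t * (1 / ((t : ℂ) - w) ^ (m + 1 + 1))‖)
    (Metric.ball_mem_nhds w (half_pos hw)) ?_ (hint m) ?_ ?_ ?_ ?_
  · refine key.2.congr_deriv ?_
    rw [← integral_const_mul]
    refine integral_congr_ae (Eventually.of_forall fun t => ?_)
    simp only
    ring
  · filter_upwards [Metric.ball_mem_nhds w (half_pos hw)] with x hx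
    exact hmeas x m (hball x hx)
  · exact hu.1.mul ((continuous_inv_sub_pow hw.ne' (m + 1)).const_mul _).aestronglyMeasurable
  · refine Eventually.of_forall fun t x hx => ?_
    have hpos : 0 < ‖(t : ℂ) - w‖ := hw.trans_le (im_le_norm_sub (by simp))
    have e : ‖((m : ℂ) + 1)‖ = m + 1 := by
      have : ((m : ℂ) + 1) = ((m + 1 : ℕ) : ℂ) := by push_cast; rfl
      rw [this, Complex.norm_natCast]
      push_cast; rfl
    rw [norm_mul, norm_mul, norm_mul, e, norm_div, norm_div, norm_one, norm_pow, norm_pow]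
    calc ‖u t‖ * ((m + 1) * (1 / ‖(t : ℂ) - x‖ ^ (m + 1 + 1)))
        ≤ ‖u t‖ * ((m + 1) * (1 / (‖(t : ℂ) - w‖ / 2) ^ (m + 1 + 1))) := by
          gcongr
          exact hlow x hx t
      _ = _ := by
          rw [div_pow]
          field_simp
  · exact (hint (m + 1)).norm.const_mul _
  · exact Eventually.of_forall fun t x hx =>
      (hasDerivAt_inv_sub_pow t (ofReal_sub_ne_zero (hball x hx).ne' t) m).const_mul (u t)

theorem iteratedDeriv_cauchyIntegral {u : ℝ → ℂ} (hu : MemLp u 2 volume) (m : ℕ) :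
    ∀ {w : ℂ}, 0 < w.im →
      iteratedDeriv m (fun x : ℂ => ∫ t : ℝ, u t * (1 / (t - x) ^ (0 + 1))) w
        = m.factorial * ∫ t : ℝ, u t * (1 / (t - w) ^ (m + 1)) := by
  induction m with
  | zero => intro w hw; simp
  | succ m ih =>
    intro w hw
    rw [iteratedDeriv_succ]
    have he : iteratedDeriv m (fun x : ℂ => ∫ t : ℝ, u t * (1 / (t - x) ^ (0 + 1)))
        =ᶠ[𝓝 w] fun x => m.factorial * ∫ t : ℝ, u t * (1 / (t - x) ^ (m + 1)) := by
      filter_upwards [isOpen_upperHalf.mem_nhds hw] with x hx using ih hx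
    rw [he.deriv_eq, ((hasDerivAt_cauchyIntegral hu hw m).const_mul _).deriv,
      Nat.factorial_succ]
    push_cast
    ring

theorem MemHardyTwo.iteratedDeriv_eq {F : ℂ → ℂ} (hF : MemHardyTwo F) {u : ℝ → ℂ}
    (hu : MemLp u 2 volume) (hFu : HasBoundaryValues F u) {w : ℂ} (hw : 0 < w.im) (n : ℕ) :
    2 * Real.pi * Complex.I * iteratedDeriv n F w
      = n.factorial * ∫ t : ℝ, u t * (1 / (t - w) ^ (n + 1)) := by
  rw [← iteratedDeriv_cauchyIntegral hu n hw, ← iteratedDeriv_const_mul_field]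
  refine Filter.EventuallyEq.iteratedDeriv_eq n ?_
  filter_upwards [isOpen_upperHalf.mem_nhds hw] with x hx
  exact (hF.cauchy_boundary hu hFu hx).symm

/-! ### Toeplitz operators, the defect operator and the inner product of ℋ(φ). -/

theorem coeFn_mulOp (φ : Lp ℂ ∞ (volume : Measure ℝ)) (u : Lp ℂ 2 (volume : Measure ℝ)) :
    mulOp φ u =ᵐ[volume] fun x => φ x * u x :=
  (ContinuousLinearMap.mul ℂ ℂ).coeFn_holder φ u

theorem inner_mulOp_star (φ : Lp ℂ ∞ (volume : Measure ℝ)) (u v : Lp ℂ 2 (volume : Measure ℝ)) :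
    inner ℂ (mulOp (star φ) u) v = inner ℂ u (mulOp φ v) := by
  rw [L2.inner_def, L2.inner_def]
  refine integral_congr_ae ?_
  filter_upwards [coeFn_mulOp φ v, coeFn_mulOp (star φ) u, Lp.coeFn_star φ] with x h1 h2 h3
  rw [h1, h2, h3]
  simp only [RCLike.inner_apply, Pi.star_apply, RCLike.star_def, map_mul, RCLike.conj_conj]
  ring

theorem norm_mulOp_le {φ : Lp ℂ ∞ (volume : Measure ℝ)} (hφ : ∀ᵐ x, ‖φ x‖ ≤ 1)
    (u : Lp ℂ 2 (volume : Measure ℝ)) : ‖mulOp φ u‖ ≤ ‖u‖ := by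
  refine Lp.norm_le_norm_of_ae_le ?_
  filter_upwards [coeFn_mulOp φ u, hφ] with x h1 h2
  rw [h1, norm_mul]
  exact mul_le_of_le_one_left (norm_nonneg _) h2

theorem toeplitz_apply (φ : Lp ℂ ∞ (volume : Measure ℝ)) (u : H2) :
    toeplitz φ u = Pplus (mulOp φ u) := rfl

theorem inner_Pplus_left (u : Lp ℂ 2 (volume : Measure ℝ)) (v : H2) :
    inner ℂ (Pplus u) v = inner ℂ u (v : Lp ℂ 2 (volume : Measure ℝ)) :=
  Submodule.inner_orthogonalProjectionOnto_eq_of_mem_right _ _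

theorem inner_Pplus_right (u : Lp ℂ 2 (volume : Measure ℝ)) (v : H2) :
    inner ℂ v (Pplus u) = inner ℂ (v : Lp ℂ 2 (volume : Measure ℝ)) u :=
  Submodule.inner_orthogonalProjectionOnto_eq_of_mem_left _ _

theorem inner_toeplitz_star (φ : Lp ℂ ∞ (volume : Measure ℝ)) (u v : H2) :
    inner ℂ (toeplitz (star φ) u) v = inner ℂ u (toeplitz φ v) := by
  rw [toeplitz_apply, toeplitz_apply, inner_Pplus_left, inner_Pplus_right, inner_mulOp_star]

theorem inner_toeplitz (φ : Lp ℂ ∞ (volume : Measure ℝ)) (u v : H2) :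
    inner ℂ (toeplitz φ u) v = inner ℂ u (toeplitz (star φ) v) := by
  rw [← inner_conj_symm (𝕜 := ℂ) (toeplitz φ u) v, ← inner_toeplitz_star]
  exact inner_conj_symm (𝕜 := ℂ) u _

theorem norm_toeplitz_le {φ : Lp ℂ ∞ (volume : Measure ℝ)} (hφ : ∀ᵐ x, ‖φ x‖ ≤ 1) (u : H2) :
    ‖toeplitz φ u‖ ≤ ‖u‖ := by
  rw [toeplitz_apply]
  exact (Submodule.norm_orthogonalProjectionOnto_apply_le H2 _).trans (norm_mulOp_le hφ u)

/-- The quadratic form is ‖u‖² - ‖T_φ̄ u‖², and T_φ̄ is a contraction. -/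
theorem isPositive_one_sub_toeplitz {φ : Lp ℂ ∞ (volume : Measure ℝ)} (hφ : ∀ᵐ x, ‖φ x‖ ≤ 1) :
    (1 - toeplitz φ * toeplitz (star φ)).IsPositive := by
  have hφ' : ∀ᵐ x, ‖(star φ : Lp ℂ ∞ (volume : Measure ℝ)) x‖ ≤ 1 := by
    filter_upwards [hφ, Lp.coeFn_star φ] with x h1 h2
    rw [h2]
    simpa using h1
  have e : ∀ u : H2, (1 - toeplitz φ * toeplitz (star φ)) u
      = u - toeplitz φ (toeplitz (star φ) u) := fun _ => rfl
  refine ContinuousLinearMap.isPositive_def.2 ⟨fun u v => ?_, fun u => ?_⟩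
  · rw [ContinuousLinearMap.coe_coe, e, e, inner_sub_left, inner_sub_right, inner_toeplitz,
      inner_toeplitz_star φ u, ← inner_toeplitz_star]
  · rw [ContinuousLinearMap.reApplyInnerSelf_apply, e, inner_sub_left, inner_toeplitz, map_sub]
    have h : ∀ v : H2, RCLike.re (inner ℂ v v) = ‖v‖ ^ 2 := fun v =>
      inner_self_eq_norm_sq (𝕜 := ℂ) v
    rw [h]
    refine sub_nonneg.2 ((h (toeplitz (star φ) u)).trans_le ?_)
    gcongr
    exact norm_toeplitz_le hφ' u

section opSqrt

variable {H : Type*} [NormedAddCommGroup H] [InnerProductSpace ℂ H] [CompleteSpace H]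

theorem opSqrt_opSqrt {A : H →L[ℂ] H} (hA : A.IsPositive) (x : H) :
    opSqrt A (opSqrt A x) = A x := by
  have := congrArg (fun T : H →L[ℂ] H => T x)
    (CFC.sqrt_mul_sqrt_self A ((ContinuousLinearMap.nonneg_iff_isPositive _).2 hA))
  exact this

theorem inner_opSqrt (A : H →L[ℂ] H) (x y : H) :
    inner ℂ (opSqrt A x) y = inner ℂ x (opSqrt A y) :=
  ((ContinuousLinearMap.nonneg_iff_isPositive _).1
    (CFC.sqrt_nonneg A)).inner_left_eq_inner_right x y

end opSqrt

theorem defect_defect {φ : Lp ℂ ∞ (volume : Measure ℝ)} (hφ : ∀ᵐ x, ‖φ x‖ ≤ 1) (u : H2) :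
    defect φ (defect φ u) = u - toeplitz φ (toeplitz (star φ) u) := by
  exact opSqrt_opSqrt (isPositive_one_sub_toeplitz hφ) u

theorem inner_defect (φ : Lp ℂ ∞ (volume : Measure ℝ)) (u v : H2) :
    inner ℂ (defect φ u) v = inner ℂ u (defect φ v) :=
  inner_opSqrt _ u v

/-- The kernel is closed, so its component can be projected away from any preimage. -/
theorem rangePreimage_spec {A : H2 →L[ℂ] H2} {u : H2} (hu : u ∈ LinearMap.range A.toLinearMap) :
    rangePreimage A u ∈ (LinearMap.ker A.toLinearMap)ᗮ ∧ A (rangePreimage A u) = u := by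
  have h : ∃ x ∈ (LinearMap.ker A.toLinearMap)ᗮ, A x = u := by
    obtain ⟨z, hz⟩ := hu
    have hcl : IsClosed (LinearMap.ker A.toLinearMap : Set H2) :=
      isClosed_singleton.preimage A.continuous
    have : CompleteSpace (LinearMap.ker A.toLinearMap) := hcl.completeSpace_coe
    refine ⟨z - (LinearMap.ker A.toLinearMap).starProjection z,
      Submodule.sub_starProjection_mem_orthogonal z, ?_⟩
    have h0 : A ((LinearMap.ker A.toLinearMap).starProjection z) = 0 :=
      LinearMap.mem_ker.1 (Submodule.starProjection_apply_mem _ z)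
    rw [map_sub, h0, sub_zero]
    exact hz
  rw [rangePreimage, dif_pos h]
  exact h.choose_spec

theorem rangePreimage_eq {A : H2 →L[ℂ] H2} {x : H2}
    (hx : x ∈ (LinearMap.ker A.toLinearMap)ᗮ) : rangePreimage A (A x) = x := by
  obtain ⟨h1, h2⟩ := rangePreimage_spec (A := A) (u := A x) ⟨x, rfl⟩
  have h3 : rangePreimage A (A x) - x ∈ LinearMap.ker A.toLinearMap := by
    rw [LinearMap.mem_ker]
    change A _ = 0
    rw [map_sub, h2, sub_self]
  have h4 := Submodule.inner_right_of_mem_orthogonal h3 (Submodule.sub_mem _ h1 hx)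
  exact sub_eq_zero.1 (inner_self_eq_zero.1 h4)

/-- Self-adjointness puts A v in (ker A)ᗮ, so A v is the distinguished preimage of A²v; moving A
across then turns the preimage of u back into u. -/
theorem dbrInner_defect_defect (φ : Lp ℂ ∞ (volume : Measure ℝ)) {u : H2}
    (hu : u ∈ LinearMap.range (defect φ).toLinearMap) (v : H2) :
    dbrInner φ u (defect φ (defect φ v)) = inner ℂ v u := by
  have h : defect φ v ∈ (LinearMap.ker (defect φ).toLinearMap)ᗮ := by
    rw [Submodule.mem_orthogonal]
    intro z hz
    have hz' : defect φ z = 0 := hz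
    rw [← inner_defect, hz', inner_zero_left]
  rw [dbrInner, rangePreimage_eq h, inner_defect, (rangePreimage_spec hu).2]

/-! ### Boundary functions and the derivative kernels of H². -/

theorem HasBoundaryValues.ae_eq {F : ℂ → ℂ} {u v : ℝ → ℂ} (hu : HasBoundaryValues F u)
    (hv : HasBoundaryValues F v) : u =ᵐ[volume] v := by
  filter_upwards [hu, hv] with x h1 h2 using tendsto_nhds_unique h1 h2

theorem boundaryTwo_eq {F : ℂ → ℂ} {u : H2} (hu : HasBoundaryValues F (u : Lp ℂ 2 volume)) :
    boundaryTwo F = u := by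
  have h : ∃ u : H2, HasBoundaryValues F (u : Lp ℂ 2 volume) := ⟨u, hu⟩
  rw [boundaryTwo, dif_pos h]
  exact Subtype.ext (Lp.ext (h.choose_spec.ae_eq hu))

theorem HasBoundaryValues.mul {F G : ℂ → ℂ} {u v : ℝ → ℂ} (hF : HasBoundaryValues F u)
    (hG : HasBoundaryValues G v) :
    HasBoundaryValues (fun z => F z * G z) (fun x => u x * v x) := by
  filter_upwards [hF, hG] with x h1 h2 using h1.mul h2

theorem HasBoundaryValues.congr {F G : ℂ → ℂ} {u v : ℝ → ℂ} (hF : HasBoundaryValues F u)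
    (hFG : Set.EqOn F G upperHalf) (huv : u =ᵐ[volume] v) : HasBoundaryValues G v := by
  filter_upwards [hF, huv] with x h1 h2
  rw [← h2]
  refine h1.congr' ?_
  filter_upwards [self_mem_nhdsWithin] with t ht
  exact hFG (by simpa [upperHalf] using ht)

theorem MemHardyTwo.congr {F G : ℂ → ℂ} (hF : MemHardyTwo F) (hFG : Set.EqOn F G upperHalf) :
    MemHardyTwo G := by
  obtain ⟨hd, C, hC⟩ := hF
  refine ⟨hd.congr fun z hz => (hFG hz).symm, C, fun y hy => ?_⟩
  refine le_trans (le_of_eq ?_) (hC y hy)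
  congr 1
  funext x
  exact (hFG (by simpa [upperHalf] using hy)).symm

theorem MemHardyTwo.sub {F G : ℂ → ℂ} (hF : MemHardyTwo F) (hG : MemHardyTwo G) :
    MemHardyTwo (fun z => F z - G z) := by
  obtain ⟨hF, C, hC⟩ := hF
  obtain ⟨hG, D, hD⟩ := hG
  refine ⟨hF.sub hG, C + D, fun y hy => ?_⟩
  refine (eLpNorm_sub_le (aestronglyMeasurable_line hF hy) (aestronglyMeasurable_line hG hy)
    (by norm_num)).trans ?_
  push_cast
  exact add_le_add (hC y hy) (hD y hy)

theorem MemHardyTwo.add {F G : ℂ → ℂ} (hF : MemHardyTwo F) (hG : MemHardyTwo G) :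
    MemHardyTwo (fun z => F z + G z) := by
  obtain ⟨hF, C, hC⟩ := hF
  obtain ⟨hG, D, hD⟩ := hG
  refine ⟨hF.add hG, C + D, fun y hy => ?_⟩
  refine (eLpNorm_add_le (aestronglyMeasurable_line hF hy) (aestronglyMeasurable_line hG hy)
    (by norm_num)).trans ?_
  push_cast
  exact add_le_add (hC y hy) (hD y hy)

theorem MemHardyTwo.const_mul {F : ℂ → ℂ} (hF : MemHardyTwo F) (c : ℂ) :
    MemHardyTwo (fun z => c * F z) := by
  obtain ⟨hF, C, hC⟩ := hF
  refine ⟨hF.const_mul c, ‖c‖₊ * C, fun y hy => ?_⟩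
  refine (eLpNorm_const_smul c (fun x : ℝ => F (x + y * Complex.I)) 2 volume).le.trans ?_
  push_cast
  exact mul_le_mul_right (hC y hy) _

theorem MemHardyTwo.sum {ι : Type*} {s : Finset ι} {F : ι → ℂ → ℂ}
    (hF : ∀ i ∈ s, MemHardyTwo (F i)) : MemHardyTwo (fun z => ∑ i ∈ s, F i z) := by
  classical
  induction s using Finset.induction_on with
  | empty => exact ⟨by simp, 0, fun y _ => by simp⟩
  | insert i s hi ih =>
    refine ((hF i (Finset.mem_insert_self i s)).add
      (ih fun j hj => hF j (Finset.mem_insert_of_mem hj))).congr fun z _ => ?_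
    simp only
    rw [Finset.sum_insert hi]

theorem MemHardyTwo.bounded_mul {F : ℂ → ℂ} (hF : MemHardyTwo F) (b : HInftyBall) :
    MemHardyTwo (fun z => b z * F z) := by
  obtain ⟨hF, C, hC⟩ := hF
  refine ⟨b.differentiableOn.mul hF, C, fun y hy => le_trans (eLpNorm_mono fun x => ?_) (hC y hy)⟩
  rw [norm_mul]
  exact mul_le_of_le_one_left (norm_nonneg _) (b.norm_le_one _ (by simpa [upperHalf] using hy))

/-- The kernel `z ↦ n! (i / 2π) / (z - w̄)ⁿ⁺¹` that reproduces the `n`-th derivative at `w`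
of functions in `H²(ℂ₊)`. -/
def hardyKernel (w : ℂ) (n : ℕ) (z : ℂ) : ℂ :=
  n.factorial * (Complex.I / (2 * Real.pi)) * (1 / (z - conj w) ^ (n + 1))

theorem memLp_hardyKernel {w : ℂ} (hw : 0 < w.im) (n : ℕ) :
    MemLp (fun t : ℝ => hardyKernel w n t) 2 volume :=
  (memLp_inv_sub_pow (w := conj w) (by simpa using hw.ne') n).const_mul _

/-- The pole w̄ lies below the real line, so raising a point only increases its distance to the
pole; the L² norm on ℝ bounds all the others. -/
theorem memHardyTwo_hardyKernel {w : ℂ} (hw : 0 < w.im) (n : ℕ) :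
    MemHardyTwo (hardyKernel w n) := by
  have hne : ∀ z : ℂ, 0 ≤ z.im → z - conj w ≠ 0 := fun z hz =>
    norm_pos_iff.1 (hw.trans_le (im_le_norm_sub_conj hz))
  refine ⟨DifferentiableOn.const_mul (DifferentiableOn.div (differentiableOn_const _)
    (by fun_prop) fun z hz => pow_ne_zero _ (hne z (le_of_lt hz))) _,
    (eLpNorm (fun t : ℝ => hardyKernel w n t) 2 volume).toNNReal, fun y hy => ?_⟩
  rw [ENNReal.coe_toNNReal (memLp_hardyKernel hw n).2.ne]
  refine eLpNorm_mono fun x => ?_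
  simp only [hardyKernel, norm_mul, norm_div, norm_pow]
  have hx : 0 < ‖(x : ℂ) - conj w‖ := norm_pos_iff.2 (hne x (by simp))
  gcongr
  rw [← sq_le_sq₀ (norm_nonneg _) (norm_nonneg _), ← Complex.normSq_eq_norm_sq,
    ← Complex.normSq_eq_norm_sq, Complex.normSq_apply, Complex.normSq_apply]
  simp only [Complex.sub_re, Complex.ofReal_re, Complex.conj_re, Complex.sub_im, Complex.ofReal_im,
    Complex.conj_im, Complex.add_re, Complex.mul_re, Complex.I_re, Complex.I_im, Complex.add_im,
    Complex.mul_im]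
  nlinarith [mul_pos hw hy]

theorem hasBoundaryValues_hardyKernel {w : ℂ} (hw : 0 < w.im) (n : ℕ) :
    HasBoundaryValues (hardyKernel w n) (fun t => hardyKernel w n t) := by
  refine Eventually.of_forall fun x => ?_
  have hne : (x : ℂ) - conj w ≠ 0 :=
    norm_pos_iff.1 (hw.trans_le (im_le_norm_sub_conj (by simp)))
  have hc : ContinuousAt (hardyKernel w n) x :=
    ContinuousAt.mul continuousAt_const
      (ContinuousAt.div continuousAt_const (by fun_prop) (pow_ne_zero _ hne))
  exact hc.tendsto.comp (tendsto_add_mul_I x _ nhdsWithin_le_nhds)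

/-- The boundary function of `hardyKernel w n` as an element of `H²(ℂ₊)`. -/
def hardyKernelTwo (w : ℂ) (hw : 0 < w.im) (n : ℕ) : H2 :=
  ⟨(memLp_hardyKernel hw n).toLp _, hardyTwo.le_topologicalClosure
    ⟨hardyKernel w n, memHardyTwo_hardyKernel hw n,
      (hasBoundaryValues_hardyKernel hw n).congr (fun _ _ => rfl)
        (memLp_hardyKernel hw n).coeFn_toLp.symm⟩⟩

theorem coeFn_hardyKernelTwo {w : ℂ} (hw : 0 < w.im) (n : ℕ) :
    (hardyKernelTwo w hw n : Lp ℂ 2 (volume : Measure ℝ))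
      =ᵐ[volume] fun t => hardyKernel w n t :=
  (memLp_hardyKernel hw n).coeFn_toLp

theorem conj_hardyKernel (w : ℂ) (n : ℕ) (t : ℝ) :
    conj (hardyKernel w n t)
      = -(n.factorial * (Complex.I / (2 * Real.pi))) * (1 / (t - w) ^ (n + 1)) := by
  simp only [hardyKernel, map_mul, map_div₀, map_pow, map_sub, map_one, map_ofNat, map_natCast,
    Complex.conj_ofReal, Complex.conj_I, Complex.conj_conj]
  ring

/-- This is the n-th derivative of Cauchy's formula: conjugation moves the pole to w, and -i/(2π) ·
2πi = 1. -/
theorem inner_hardyKernelTwo {w : ℂ} (hw : 0 < w.im) (n : ℕ) {F : ℂ → ℂ} (hF : MemHardyTwo F)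
    {u : Lp ℂ 2 (volume : Measure ℝ)} (hFu : HasBoundaryValues F u) :
    inner ℂ (hardyKernelTwo w hw n : Lp ℂ 2 (volume : Measure ℝ)) u = iteratedDeriv n F w := by
  have h := hF.iteratedDeriv_eq (Lp.memLp u) hFu hw n
  rw [L2.inner_def]
  have e : ∫ t, inner ℂ ((hardyKernelTwo w hw n : Lp ℂ 2 (volume : Measure ℝ)) t) (u t)
      = ∫ t : ℝ, -(n.factorial * (Complex.I / (2 * Real.pi)))
        * (u t * (1 / (t - w) ^ (n + 1))) := by
    refine integral_congr_ae ?_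
    filter_upwards [coeFn_hardyKernelTwo hw n] with t ht
    rw [ht, RCLike.inner_apply, conj_hardyKernel]
    ring
  rw [e, integral_const_mul]
  have hpi : (Real.pi : ℂ) ≠ 0 := by exact_mod_cast Real.pi_ne_zero
  have e2 : -(n.factorial * (Complex.I / (2 * Real.pi))) * ∫ t : ℝ, u t * (1 / (t - w) ^ (n + 1))
      = -(Complex.I / (2 * Real.pi)) * (n.factorial * ∫ t : ℝ, u t * (1 / (t - w) ^ (n + 1))) := by
    ring
  rw [e2, ← h]
  field_simp
  rw [Complex.I_sq]
  ring

theorem coeFn_sum_smul {μ : Measure ℝ} {ι : Type*} (s : Finset ι) (c : ι → ℂ)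
    {v : ι → Lp ℂ 2 μ} {f : ι → ℝ → ℂ} (h : ∀ i ∈ s, v i =ᵐ[μ] f i) :
    (∑ i ∈ s, c i • v i : Lp ℂ 2 μ) =ᵐ[μ] fun t => ∑ i ∈ s, c i * f i t := by
  classical
  induction s using Finset.induction_on with
  | empty =>
    simp only [Finset.sum_empty]
    exact Lp.coeFn_zero ℂ 2 μ
  | insert i s hi ih =>
    rw [Finset.sum_insert hi]
    filter_upwards [Lp.coeFn_add (c i • v i) (∑ i ∈ s, c i • v i), Lp.coeFn_smul (c i) (v i),
      h i (Finset.mem_insert_self i s), ih fun j hj => h j (Finset.mem_insert_of_mem hj)]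
      with t h1 h2 h3 h4
    rw [h1, Pi.add_apply, h2, Pi.smul_apply, h3, h4, Finset.sum_insert hi, smul_eq_mul]

/-! ### The action of T_b̄ on derivative kernels, and the kernel k^b. -/

namespace HInftyBall

variable (b : HInftyBall)

/-- The coefficients of `T_{b̄}` applied to the kernel `hardyKernel ω n` in terms of the kernels
of lower order. -/
def kernelCoeff (ω : ℂ) (n p : ℕ) : ℂ := n.choose p * conj (iteratedDeriv p b ω)

/-- Powers cancel termwise, and n!/p! = C(n, p) (n - p)! produces the Leibniz coefficients. -/
theorem kernel_quotient_eq (ω : ℂ) (n : ℕ) {z : ℂ} (hz : z - conj ω ≠ 0) :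
    n.factorial * (Complex.I / (2 * Real.pi) *
      ((∑ p ∈ Finset.range (n + 1),
          conj (iteratedDeriv p b ω) / p.factorial * (z - conj ω) ^ p) / (z - conj ω) ^ (n + 1)))
      = ∑ p ∈ Finset.range (n + 1), b.kernelCoeff ω n p * hardyKernel ω (n - p) z := by
  rw [Finset.sum_div, Finset.mul_sum, Finset.mul_sum]
  refine Finset.sum_congr rfl fun p hp => ?_
  have hpn : p ≤ n := by simpa [Nat.lt_succ_iff] using hp
  obtain ⟨k, rfl⟩ := Nat.exists_eq_add_of_le hpn
  have h1 : ((p + k).factorial : ℂ) = (p + k).choose p * p.factorial * k.factorial := by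
    have := Nat.choose_mul_factorial_mul_factorial (Nat.le_add_right p k)
    rw [Nat.add_sub_cancel_left] at this
    exact_mod_cast this.symm
  have h2 : (p.factorial : ℂ) ≠ 0 := by exact_mod_cast p.factorial_ne_zero
  have hpi : (Real.pi : ℂ) ≠ 0 := by exact_mod_cast Real.pi_ne_zero
  rw [Nat.add_sub_cancel_left, kernelCoeff, hardyKernel, h1]
  field_simp
  ring

theorem kernelRho_eq {ω : ℂ} (hω : 0 < ω.im) (n : ℕ) (t : ℝ) :
    b.kernelRho ω n t
      = ∑ p ∈ Finset.range (n + 1), b.kernelCoeff ω n p * hardyKernel ω (n - p) t :=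
  b.kernel_quotient_eq ω n (norm_pos_iff.1 (hω.trans_le (im_le_norm_sub_conj (by simp))))

theorem kernelB_eq {ω : ℂ} (hω : 0 < ω.im) (n : ℕ) {z : ℂ} (hz : z ∈ upperHalf) :
    b.kernelB ω n z = hardyKernel ω n z
      - b z * ∑ p ∈ Finset.range (n + 1), b.kernelCoeff ω n p * hardyKernel ω (n - p) z := by
  rw [← b.kernel_quotient_eq ω n
    (norm_pos_iff.1 (hω.trans_le (im_le_norm_sub_conj (le_of_lt hz)))), kernelB, hardyKernel]
  ring

/-- The image `T_{b̄} K` of the kernel `K = hardyKernel ω n`. -/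
def toeplitzKernel (ω : ℂ) (hω : 0 < ω.im) (n : ℕ) : H2 :=
  ∑ p ∈ Finset.range (n + 1), b.kernelCoeff ω n p • hardyKernelTwo ω hω (n - p)

theorem coe_toeplitzKernel {ω : ℂ} (hω : 0 < ω.im) (n : ℕ) :
    (b.toeplitzKernel ω hω n : Lp ℂ 2 (volume : Measure ℝ))
      = ∑ p ∈ Finset.range (n + 1), b.kernelCoeff ω n p •
        (hardyKernelTwo ω hω (n - p) : Lp ℂ 2 (volume : Measure ℝ)) := by
  rw [toeplitzKernel, Submodule.coe_sum]
  rfl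

theorem coeFn_toeplitzKernel {ω : ℂ} (hω : 0 < ω.im) (n : ℕ) :
    (b.toeplitzKernel ω hω n : Lp ℂ 2 (volume : Measure ℝ)) =ᵐ[volume] b.kernelRho ω n := by
  rw [coe_toeplitzKernel]
  refine (coeFn_sum_smul _ _ fun p _ => coeFn_hardyKernelTwo hω (n - p)).trans ?_
  exact Eventually.of_forall fun t => (b.kernelRho_eq hω n t).symm

theorem hasBoundaryValues_mulOp {F : ℂ → ℂ} {u : Lp ℂ 2 (volume : Measure ℝ)}
    (hFu : HasBoundaryValues F u) :
    HasBoundaryValues (fun z => b z * F z) (mulOp b.bdry u) :=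
  (b.hasBoundaryValues_bdry.mul hFu).congr (fun _ _ => rfl) (coeFn_mulOp _ _).symm

theorem iteratedDeriv_mul_eq {F : ℂ → ℂ} (hF : DifferentiableOn ℂ F upperHalf) {ω : ℂ}
    (hω : 0 < ω.im) (n : ℕ) :
    iteratedDeriv n (fun z => b z * F z) ω = ∑ p ∈ Finset.range (n + 1),
      n.choose p * iteratedDeriv p b ω * iteratedDeriv (n - p) F ω := by
  have hU : upperHalf ∈ 𝓝 ω := isOpen_upperHalf.mem_nhds hω
  exact iteratedDeriv_fun_mul (b.differentiableOn.analyticAt hU).contDiffAt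
    (hF.analyticAt hU).contDiffAt

/-- For h with an analytic extension F, both sides are (bF)⁽ⁿ⁾(ω), by the Leibniz rule. Continuity
carries the identity to the closure that defines `H2`. -/
theorem inner_hardyKernelTwo_mulOp {ω : ℂ} (hω : 0 < ω.im) (n : ℕ) (h : H2) :
    inner ℂ (hardyKernelTwo ω hω n : Lp ℂ 2 (volume : Measure ℝ))
        (mulOp b.bdry (h : Lp ℂ 2 (volume : Measure ℝ)))
      = inner ℂ (b.toeplitzKernel ω hω n : Lp ℂ 2 (volume : Measure ℝ))
        (h : Lp ℂ 2 (volume : Measure ℝ)) := by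
  have hcl : IsClosed {x : Lp ℂ 2 (volume : Measure ℝ) |
      inner ℂ (hardyKernelTwo ω hω n : Lp ℂ 2 (volume : Measure ℝ)) (mulOp b.bdry x)
      = inner ℂ (b.toeplitzKernel ω hω n : Lp ℂ 2 (volume : Measure ℝ)) x} :=
    isClosed_eq (by fun_prop) (by fun_prop)
  have hsub : (hardyTwo : Set (Lp ℂ 2 (volume : Measure ℝ))) ⊆
      {x : Lp ℂ 2 (volume : Measure ℝ) |
      inner ℂ (hardyKernelTwo ω hω n : Lp ℂ 2 (volume : Measure ℝ)) (mulOp b.bdry x)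
      = inner ℂ (b.toeplitzKernel ω hω n : Lp ℂ 2 (volume : Measure ℝ)) x} := by
    rintro x ⟨F, hF, hFx⟩
    rw [Set.mem_ofPred_eq, inner_hardyKernelTwo hω n (hF.bounded_mul b)
      (b.hasBoundaryValues_mulOp hFx), b.iteratedDeriv_mul_eq hF.1 hω, coe_toeplitzKernel,
      sum_inner]
    refine Finset.sum_congr rfl fun p _ => ?_
    rw [inner_smul_left, inner_hardyKernelTwo hω (n - p) hF hFx, kernelCoeff, map_mul,
      Complex.conj_conj, Complex.conj_natCast]
  exact closure_minimal hsub hcl h.2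

theorem toeplitz_star_hardyKernelTwo {ω : ℂ} (hω : 0 < ω.im) (n : ℕ) :
    toeplitz (star b.bdry) (hardyKernelTwo ω hω n) = b.toeplitzKernel ω hω n := by
  refine ext_inner_right ℂ fun h => ?_
  rw [inner_toeplitz_star, toeplitz_apply, inner_Pplus_right, b.inner_hardyKernelTwo_mulOp hω n h]
  rfl

theorem hasBoundaryValues_kernelRho {ω : ℂ} (hω : 0 < ω.im) (n : ℕ) :
    HasBoundaryValues
      (fun z => ∑ p ∈ Finset.range (n + 1), b.kernelCoeff ω n p * hardyKernel ω (n - p) z)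
      (b.toeplitzKernel ω hω n : Lp ℂ 2 (volume : Measure ℝ)) := by
  have h : HasBoundaryValues
      (fun z => ∑ p ∈ Finset.range (n + 1), b.kernelCoeff ω n p * hardyKernel ω (n - p) z)
      (fun t => ∑ p ∈ Finset.range (n + 1), b.kernelCoeff ω n p * hardyKernel ω (n - p) t) := by
    have := ae_all_iff.2 fun p : ℕ => hasBoundaryValues_hardyKernel hω (n - p)
    filter_upwards [this] with x hx
    exact tendsto_finsetSum _ fun p _ => (hx p).const_mul _
  refine h.congr (fun _ _ => rfl) ?_
  filter_upwards [b.coeFn_toeplitzKernel hω n] with t ht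
  rw [ht, kernelRho_eq b hω]

theorem memHardyTwo_sum_hardyKernel {ω : ℂ} (hω : 0 < ω.im) (n : ℕ) :
    MemHardyTwo
      (fun z => ∑ p ∈ Finset.range (n + 1), b.kernelCoeff ω n p * hardyKernel ω (n - p) z) :=
  MemHardyTwo.sum fun p _ => (memHardyTwo_hardyKernel hω (n - p)).const_mul _

theorem memHardyTwo_kernelB {ω : ℂ} (hω : 0 < ω.im) (n : ℕ) : MemHardyTwo (b.kernelB ω n) :=
  ((memHardyTwo_hardyKernel hω n).sub ((b.memHardyTwo_sum_hardyKernel hω n).bounded_mul b)).congr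
    fun _ hz => (b.kernelB_eq hω n hz).symm

/-- The product with b already is the boundary function of an H² function, so P₊ fixes it. -/
theorem coe_toeplitz_toeplitzKernel {ω : ℂ} (hω : 0 < ω.im) (n : ℕ) :
    (toeplitz b.bdry (b.toeplitzKernel ω hω n) : Lp ℂ 2 (volume : Measure ℝ))
      = mulOp b.bdry (b.toeplitzKernel ω hω n) := by
  have hmem : mulOp b.bdry (b.toeplitzKernel ω hω n) ∈ H2 :=
    hardyTwo.le_topologicalClosure ⟨_, (b.memHardyTwo_sum_hardyKernel hω n).bounded_mul b,
      b.hasBoundaryValues_mulOp (b.hasBoundaryValues_kernelRho hω n)⟩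
  rw [toeplitz_apply, Pplus]
  exact congrArg Subtype.val (Submodule.orthogonalProjectionOnto_mem_subspace_eq_self
    (K := H2) ⟨_, hmem⟩)

theorem defect_defect_hardyKernelTwo {ω : ℂ} (hω : 0 < ω.im) (n : ℕ) :
    defect b.bdry (defect b.bdry (hardyKernelTwo ω hω n))
      = hardyKernelTwo ω hω n - toeplitz b.bdry (b.toeplitzKernel ω hω n) := by
  rw [defect_defect b.norm_bdry_le, toeplitz_star_hardyKernelTwo]

/-- This identifies k^b with A²K, the source both of its membership in ℋ(b) and of its reproducing
property. -/
theorem hasBoundaryValues_kernelB {ω : ℂ} (hω : 0 < ω.im) (n : ℕ) :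
    HasBoundaryValues (b.kernelB ω n)
      (defect b.bdry (defect b.bdry (hardyKernelTwo ω hω n)) : Lp ℂ 2 (volume : Measure ℝ)) := by
  rw [defect_defect_hardyKernelTwo, Submodule.coe_sub, coe_toeplitz_toeplitzKernel]
  have h1 := hasBoundaryValues_hardyKernel hω n
  have h2 := b.hasBoundaryValues_mulOp (b.hasBoundaryValues_kernelRho hω n)
  have h3 : HasBoundaryValues
      (fun z => hardyKernel ω n z
        - b z * ∑ p ∈ Finset.range (n + 1), b.kernelCoeff ω n p * hardyKernel ω (n - p) z)
      (fun t => hardyKernel ω n t - mulOp b.bdry (b.toeplitzKernel ω hω n) t) := by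
    filter_upwards [h1, h2] with x hx1 hx2 using hx1.sub hx2
  refine h3.congr (fun z hz => (b.kernelB_eq hω n hz).symm) ?_
  filter_upwards [coeFn_hardyKernelTwo hω n, Lp.coeFn_sub
    (hardyKernelTwo ω hω n : Lp ℂ 2 (volume : Measure ℝ))
    (mulOp b.bdry (b.toeplitzKernel ω hω n))] with t ht1 ht2
  rw [ht2, Pi.sub_apply, ht1]

theorem memDBR_kernelB {ω : ℂ} (hω : 0 < ω.im) (n : ℕ) : MemDBR b.bdry (b.kernelB ω n) :=
  ⟨b.memHardyTwo_kernelB hω n, _, ⟨defect b.bdry (hardyKernelTwo ω hω n), rfl⟩,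
    b.hasBoundaryValues_kernelB hω n⟩

/-! ### The space L²(ρ) and the kernel k^ρ. -/

theorem rho_nonneg_ae : ∀ᵐ t : ℝ, 0 ≤ b.rho t := by
  filter_upwards [b.norm_bdry_le] with t ht
  have := norm_nonneg (b.bdry t)
  unfold rho
  nlinarith

theorem rhoMeasure_le : b.rhoMeasure ≤ volume := by
  have h : (fun t => ENNReal.ofReal (b.rho t)) ≤ᵐ[volume] fun _ => 1 := by
    refine Eventually.of_forall fun t => ENNReal.ofReal_le_one.2 ?_
    unfold rho
    nlinarith [sq_nonneg ‖b.bdry t‖]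
  have h2 := withDensity_mono h
  rwa [show (fun _ : ℝ => (1 : ℝ≥0∞)) = 1 from rfl, withDensity_one] at h2

theorem integral_rhoMeasure (h : ℝ → ℂ) :
    ∫ t, h t ∂b.rhoMeasure = ∫ t, (b.rho t : ℂ) * h t := by
  rw [rhoMeasure, integral_withDensity_eq_integral_toReal_smul b.measurable_rho.ennreal_ofReal
    (Eventually.of_forall fun t => ENNReal.ofReal_lt_top)]
  refine integral_congr_ae ?_
  filter_upwards [b.rho_nonneg_ae] with t ht
  rw [ENNReal.toReal_ofReal ht, Complex.real_smul]

/-- The kernel `hardyKernel w n` as an element of `L²(ρ)`. -/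
def hardyKernelRho (w : ℂ) (hw : 0 < w.im) (n : ℕ) : b.L2rho :=
  ((memLp_hardyKernel hw n).mono_measure b.rhoMeasure_le).toLp _

theorem coeFn_hardyKernelRho {w : ℂ} (hw : 0 < w.im) (n : ℕ) :
    b.hardyKernelRho w hw n =ᵐ[b.rhoMeasure] fun t => hardyKernel w n t :=
  MemLp.coeFn_toLp _

theorem inner_hardyKernelRho {w : ℂ} (hw : 0 < w.im) (n : ℕ) (q : b.L2rho) :
    inner ℂ (b.hardyKernelRho w hw n) q = -(n.factorial * (Complex.I / (2 * Real.pi)))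
      * ∫ t : ℝ, (q t * (b.rho t : ℂ)) * (1 / (t - w) ^ (n + 1)) := by
  have e : inner ℂ (b.hardyKernelRho w hw n) q
      = ∫ t, q t * conj (hardyKernel w n t) ∂b.rhoMeasure := by
    rw [L2.inner_def]
    refine integral_congr_ae ?_
    filter_upwards [b.coeFn_hardyKernelRho hw n] with t ht
    rw [ht, RCLike.inner_apply]
  rw [e, integral_rhoMeasure, ← integral_const_mul]
  refine integral_congr_ae (Eventually.of_forall fun t => ?_)
  simp only [conj_hardyKernel]
  ring

/-- By double orthogonality it suffices to test against q orthogonal to all k_v. For such q the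
Cauchy integral of qρ vanishes on ℂ₊, hence so do its derivatives, which are the pairings with the
higher kernels up to nonzero factors and conjugation. -/
theorem hardyKernelRho_mem {w : ℂ} (hw : 0 < w.im) (n : ℕ) :
    b.hardyKernelRho w hw n ∈ b.H2rho := by
  rw [H2rho, ← Submodule.orthogonal_orthogonal_eq_closure, Submodule.mem_orthogonal]
  intro q hq
  rw [Submodule.mem_orthogonal] at hq
  have h0 : ∀ v : ℂ, 0 < v.im →
      ∫ t : ℝ, (q t * (b.rho t : ℂ)) * (1 / (t - v) ^ (0 + 1)) = 0 := by
    intro v hv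
    have h1 := hq (b.hardyKernelRho v hv 0) (Submodule.subset_span ⟨v, hv, ?_⟩)
    · rw [inner_hardyKernelRho] at h1
      refine (mul_eq_zero.1 h1).resolve_left ?_
      simp
    · filter_upwards [b.coeFn_hardyKernelRho hv 0] with t ht
      rw [ht, hardyKernel]
      simp
  have h1 := iteratedDeriv_cauchyIntegral (b.memLp_mul_rho q) n hw
  have h2 : (fun x : ℂ => ∫ t : ℝ, (q t * (b.rho t : ℂ)) * (1 / (t - x) ^ (0 + 1)))
      =ᶠ[𝓝 w] fun _ => 0 := by
    filter_upwards [isOpen_upperHalf.mem_nhds hw] with x hx using h0 x hx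
  rw [h2.iteratedDeriv_eq n] at h1
  have h3 : iteratedDeriv n (fun _ : ℂ => (0 : ℂ)) w = 0 := by simp
  rw [h3] at h1
  have h4 : ∫ t : ℝ, (q t * (b.rho t : ℂ)) * (1 / (t - w) ^ (n + 1)) = 0 :=
    (mul_eq_zero.1 h1.symm).resolve_left (by exact_mod_cast n.factorial_ne_zero)
  rw [← inner_conj_symm, inner_hardyKernelRho, h4, mul_zero, map_zero]

theorem exists_mem_H2rho_kernelRho {ω : ℂ} (hω : 0 < ω.im) (n : ℕ) :
    ∃ q ∈ b.H2rho, (q : ℝ → ℂ) =ᵐ[b.rhoMeasure] b.kernelRho ω n := by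
  refine ⟨∑ p ∈ Finset.range (n + 1), b.kernelCoeff ω n p • b.hardyKernelRho ω hω (n - p),
    Submodule.sum_mem _ fun p _ => Submodule.smul_mem _ _ (b.hardyKernelRho_mem hω _), ?_⟩
  refine (coeFn_sum_smul _ _ fun p _ => b.coeFn_hardyKernelRho hω (n - p)).trans ?_
  exact Eventually.of_forall fun t => (b.kernelRho_eq hω n t).symm

/-- On the real line k^ρ represents T_b̄ K, an element of H², so the projection in C_ρ can be
dropped. -/
theorem integral_mul_conj_kernelRho {ω : ℂ} (hω : 0 < ω.im) (n : ℕ) (g : b.L2rho) :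
    ∫ t : ℝ, g t * (b.rho t : ℂ) * conj (b.kernelRho ω n t)
      = inner ℂ (b.toeplitzKernel ω hω n) (b.Crho g) := by
  rw [Crho, inner_Pplus_right, L2.inner_def]
  refine integral_congr_ae ?_
  filter_upwards [b.coeFn_toeplitzKernel hω n, (b.memLp_mul_rho g).coeFn_toLp] with t h1 h2
  rw [h1, h2, RCLike.inner_apply]

theorem integrable_mul_conj_kernelRho {ω : ℂ} (hω : 0 < ω.im) (n : ℕ) (g : b.L2rho) :
    Integrable fun t : ℝ => g t * (b.rho t : ℂ) * conj (b.kernelRho ω n t) := by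
  have h : MemLp (b.kernelRho ω n) 2 volume :=
    (Lp.memLp (b.toeplitzKernel ω hω n : Lp ℂ 2 (volume : Measure ℝ))).ae_eq
      (b.coeFn_toeplitzKernel hω n)
  exact integrable_mul_of_memLp_two (b.memLp_mul_rho g) h.star

end HInftyBall

theorem integral_mul_conj_eq_inner (u v : H2) :
    ∫ t : ℝ, (u : Lp ℂ 2 (volume : Measure ℝ)) t * conj ((v : Lp ℂ 2 (volume : Measure ℝ)) t)
      = inner ℂ v u := by
  rw [Submodule.coe_inner, L2.inner_def]
  simp only [RCLike.inner_apply]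

end DBR

end

theorem mainTheorem5 (b : DBR.HInftyBall) (f : ℂ → ℂ) (hf : DBR.MemDBR b.bdry f)
    (g : b.L2rho) (hg : g ∈ b.H2rho)
    (hfg : DBR.toeplitz (star b.bdry) (DBR.boundaryTwo f) = b.Crho g)
    (ω : ℂ) (hω : 0 < ω.im) (n : ℕ) :
    DBR.MemDBR b.bdry (b.kernelB ω n) ∧
    (∃ q ∈ b.H2rho, (q : ℝ → ℂ) =ᵐ[b.rhoMeasure] b.kernelRho ω n) ∧
    iteratedDeriv n f ω =
      DBR.dbrInner b.bdry (DBR.boundaryTwo f) (DBR.boundaryTwo (b.kernelB ω n)) ∧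
    Integrable (fun t : ℝ =>
      (DBR.boundaryTwo f : Lp ℂ 2 volume) t *
        conj ((DBR.boundaryTwo (b.kernelB ω n) : Lp ℂ 2 volume) t)) ∧
    Integrable (fun t : ℝ => g t * (b.rho t : ℂ) * conj (b.kernelRho ω n t)) ∧
    DBR.dbrInner b.bdry (DBR.boundaryTwo f) (DBR.boundaryTwo (b.kernelB ω n)) =
      (∫ t : ℝ, (DBR.boundaryTwo f : Lp ℂ 2 volume) t *
        conj ((DBR.boundaryTwo (b.kernelB ω n) : Lp ℂ 2 volume) t)) +
      ∫ t : ℝ, g t * (b.rho t : ℂ) * conj (b.kernelRho ω n t) := by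
  obtain ⟨hfH, u, hu, hfu⟩ := hf
  rw [DBR.boundaryTwo_eq hfu] at hfg ⊢
  have hB := DBR.boundaryTwo_eq (b.hasBoundaryValues_kernelB hω n)
  have hinner : DBR.dbrInner b.bdry u (DBR.boundaryTwo (b.kernelB ω n))
      = inner ℂ (DBR.hardyKernelTwo ω hω n) u := by
    rw [hB, DBR.dbrInner_defect_defect b.bdry hu]
  refine ⟨b.memDBR_kernelB hω n, b.exists_mem_H2rho_kernelRho hω n, ?_,
    DBR.integrable_mul_of_memLp_two (Lp.memLp _) (Lp.memLp _).star,
    b.integrable_mul_conj_kernelRho hω n g, ?_⟩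
  · rw [hinner, Submodule.coe_inner, DBR.inner_hardyKernelTwo hω n hfH hfu]
  -- Both sides are compared with ⟨f, K⟩₂: in ⟨f, K - T_b T_b̄ K⟩₂ the operator T_b moves across,
  -- and the resulting ⟨T_b̄ f, T_b̄ K⟩₂ cancels the second integral because T_b̄ f = C_ρ g.
  · rw [hinner, DBR.integral_mul_conj_eq_inner, b.integral_mul_conj_kernelRho hω n g, hB,
      b.defect_defect_hardyKernelTwo hω n, ← hfg, inner_sub_left, DBR.inner_toeplitz]
    ring
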